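/- Let $A$ be an associative ring with $1$ and with an involution $a\mapsto\bar a$, and let $C$, $C'$ be finite-dimensional chain complexes of left $A$-modules, i.e. each is chain homotopy equivalent to a complex of finitely generated projective modules concentrated in degrees $0,\dots,m$ for some $m$. *Conventions.* $C^t\otimes_AD$ has $d(x\otimes y)=x\otimes dy+(-1)^q\,dx\otimes y$ for $y\in D_q$, and the transposition is $T(x\otimes y)=(-1)^{pq}y\otimes x$ for $x\in C_p$, $y\in D_q$. $(\widehat W^{\%}C)_n$ is the group of families $\theta=\{\theta_s\in(C^t\otimes_AC)_{n+s}\mid s\in\mathbb Z\}$ with $(d\theta)_s=d(\theta_s)+(-1)^{n+s-1}(\theta_{s-1}+(-1)^sT\theta_{s-1})$; $(W^{\%}C)_n$ is the group of families $\{\phi_s\mid s\ge 0\}$, with the same differential ($\phi_{-1}=0$), and $J:W^{\%}C\to\widehat W^{\%}C$ is extension by $0$; $(W_{\%}C)_n$ is the group of finitely supported families $\{\psi_s\in(C^t\otimes_AC)_{n-s}\mid s\ge0\}$ with $(d\psi)_s=d(\psi_s)+(-1)^{n-s-1}(\psi_{s+1}+(-1)^{s+1}T\psi_{s+1})$, and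 $Q_n(C)=H_n(W_{\%}C)$. A bundle over $C$ is a cycle $\gamma\in(\widehat W^{\%}C^{0-*})_0$, where $(C^{0-*})_r=\mathrm{Hom}_A(C_{-r},A)$ with differential $(-1)^rd^*$; then $(C,\gamma)$ is a chain bundle. Elements of $(C^t\otimes_AD)_n$ act as degree $n$ morphisms $C^{0-*}\to D$ by $(x\otimes y)(u)=\overline{u(x)}\,y$, cycles being the chain maps $f:C^{n-*}\to D$. For $f\in(C^t\otimes_AD)_m$, $g\in (C^t\otimes_AD)_{m'}$ let $(f\otimes g)(u\otimes v)=(-1)^{mq}f(u)\otimes g(v)$ for $v$ of degree $q$ in $C^{0-*}$, and set, for $f,f'$ of degree $n$ and $g$ of degree $n+1$, $$\widehat f^{\%}(S^n\gamma)_s=(f\otimes f)\gamma_{s-n},\qquad [f,f'](S^n\gamma)_s=(-1)^{n+1}T(f\otimes f')\gamma_{s-n+1},$$ $$(g;f,f')^{\%}(S^n\gamma)_s=(f\otimes g)\gamma_{s-n}+(-1)^n(g\otimes f')\gamma_{s-n}-T(g\otimes g)\gamma_{s-n-1}.$$ For $n\in\mathbb Z$, the twisted quadratic group $Q_n(C,\gamma)$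 is the abelian group of pairs $(\phi,\theta)$, where $\phi\in(W^{\%}C)_n$ is a cycle and $\theta\in(\widehat W^{\%}C)_{n+1}$ satisfies $J(\phi)-\widehat\phi_0^{\%}(S^n\gamma)=d\theta$, modulo the relation $(\phi,\theta)\sim(\phi',\theta')$ if there are $\xi\in(W^{\%}C)_{n+1}$, $\eta\in(\widehat W^{\%}C)_{n+2}$ with $\phi'-\phi=d\xi$ and $\theta'-\theta-J(\xi)+(\xi_0;\phi_0,\phi_0')^{\%}(S^n\gamma)=d\eta$; addition is $(\phi,\theta)+(\phi',\theta')=(\phi+\phi',\theta+\theta'+[\phi_0,\phi'_0](S^n\gamma))$. *Statement.* Let $(C,\gamma)$, $(C',\gamma')$ be chain bundles over $A$. Let $i,i'$ be the inclusions of $C,C'$ in $C\oplus C'$, let $j,j'$ be the projections, and let $\gamma\oplus\gamma'=j^*\gamma+j'^*\gamma'$. There are well-defined homomorphisms, for all $n\in\mathbb Z$, $$i_*:Q_n(C,\gamma)\oplus Q_n(C',\gamma')\to Q_n(C\oplus C',\gamma\oplus\gamma'),\quad ((\phi,\theta),(\phi',\theta'))\mapsto i_{\%}(\phi,\theta)+i'_{\%}(\phi',\theta'),$$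 $$j_*:Q_n(C\oplus C',\gamma\oplus\gamma')\to H_n(C^t\otimes_AC'),\quad(\phi,\theta)\mapsto(j\otimes j')\phi_0,$$ $$k_*:H_n(C^t\otimes_AC')\to Q_{n-1}(C,\gamma)\oplus Q_{n-1}(C',\gamma'),\quad f\mapsto\big((0,\widehat{f^*}^{\%}(S^n\gamma')),(0,-\widehat f^{\%}(S^n\gamma))\big),$$ where a cycle $f$ is regarded as a chain map $f:C^{n-*}\to C'$ and $f^*=Tf:C'^{\,n-*}\to C$, and the sequence $$\cdots\to Q_n(C,\gamma)\oplus Q_n(C',\gamma')\xrightarrow{i_*}Q_n(C\oplus C',\gamma\oplus\gamma')\xrightarrow{j_*}H_n(C^t\otimes_AC')\xrightarrow{k_*}Q_{n-1}(C,\gamma)\oplus Q_{n-1}(C',\gamma')\xrightarrow{i_*}\cdots$$ is exact. If $\gamma=0$ and $\gamma'=0$, then $k_*=0$ for all $n$, and under the isomorphisms $Q_n(D)\cong Q_n(D,0)$, $\psi\mapsto((1+T)\psi_0,\theta)$ with $\theta_s=(-1)^n\psi_{-s-1}$ for $s\le-1$ and $\theta_s=0$ for $s\ge0$ ($D=C$,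 $C'$, $C\oplus C'$), the sequence becomes the split short exact sequences $$0\to Q_n(C)\oplus Q_n(C')\xrightarrow{(i_{\%}\;\,i'_{\%})}Q_n(C\oplus C')\to H_n(C^t\otimes_AC')\to0,$$ the second map being $\psi\mapsto(j\otimes j')(1+T)\psi_0$. -/

import Mathlib

open CategoryTheory CategoryTheory.Limits
open scoped TensorProduct DirectSum

universe u

namespace ChainBundle

noncomputable section

/-! ### Modules over a ring with involution -/

section Modules

variable (A : Type u) [Ring A]

/-- The dual `M^* = Hom_A(M, A)` of a left `A`-module `M`, with the left action
`(a • f) x = f x * star a`. -/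
def Dual (M : Type u) [AddCommGroup M] [Module A M] : Type u := M →ₗ[A] A

variable (M : Type u) [AddCommGroup M] [Module A M]
variable (N : Type u) [AddCommGroup N] [Module A N]
variable (M' : Type u) [AddCommGroup M'] [Module A M']
variable (N' : Type u) [AddCommGroup N'] [Module A N']

instance : AddCommGroup (Dual A M) := inferInstanceAs (AddCommGroup (M →ₗ[A] A))

instance : FunLike (Dual A M) M A := inferInstanceAs (FunLike (M →ₗ[A] A) M A)

instance : LinearMapClass (Dual A M) A M A :=
  inferInstanceAs (LinearMapClass (M →ₗ[A] A) A M A)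

variable {A M} in
@[ext] theorem Dual.ext {f g : Dual A M} (h : ∀ x, f x = g x) : f = g := DFunLike.ext f g h

variable {A M} in
@[simp] theorem Dual.add_apply (f g : Dual A M) (x : M) : (f + g) x = f x + g x := rfl

variable [StarRing A]

instance : SMul A (Dual A M) where
  smul a f :=
    { toFun := fun x => f x * star a
      map_add' := fun x y => by rw [map_add, add_mul]
      map_smul' := fun b x => by simp [mul_assoc] }

variable {A M} in
@[simp] theorem Dual.smul_apply (a : A) (f : Dual A M) (x : M) : (a • f) x = f x * star a := rfl

instance : Module A (Dual A M) where
  one_smul f := by ext x; simp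
  mul_smul a b f := by ext x; simp [mul_assoc]
  smul_zero a := by ext x; exact zero_mul _
  smul_add a f g := by ext x; simp [add_mul]
  add_smul a b f := by ext x; simp [mul_add]
  zero_smul f := by ext x; simp only [Dual.smul_apply, star_zero, mul_zero]; rfl

variable {M N} in
/-- The dual `f^* : N^* → M^*`, `g ↦ (x ↦ g (f x))`, of a morphism `f : M → N`. -/
def dualMap (f : M →ₗ[A] N) : Dual A N →ₗ[A] Dual A M where
  toFun g := LinearMap.comp (show N →ₗ[A] A from g) f
  map_add' _ _ := rfl
  map_smul' _ _ := rfl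

variable {M N} in
@[simp] theorem dualMap_apply (f : M →ₗ[A] N) (g : Dual A N) (x : M) :
    dualMap A f g x = g (f x) := rfl

theorem dualMap_zero : dualMap A (0 : M →ₗ[A] N) = 0 := by
  ext g x
  exact map_zero g

variable {M N M'} in
theorem dualMap_comp (f : M →ₗ[A] N) (g : N →ₗ[A] M') :
    dualMap A (g.comp f) = (dualMap A f).comp (dualMap A g) := rfl

/-- The relations `(star a • x) ⊗ y = x ⊗ (a • y)`, i.e. `x a ⊗ y = x ⊗ a y` for the right action
`x a = star a • x` of `A` on `M^t`. -/
def balanced : AddSubgroup (M ⊗[ℤ] N) :=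
  AddSubgroup.closure {z | ∃ (a : A) (x : M) (y : N), z = (star a • x) ⊗ₜ[ℤ] y - x ⊗ₜ[ℤ] (a • y)}

/-- The abelian group `M^t ⊗_A N`. -/
def Tens : Type u := (M ⊗[ℤ] N) ⧸ balanced A M N

instance : AddCommGroup (Tens A M N) :=
  inferInstanceAs (AddCommGroup ((M ⊗[ℤ] N) ⧸ balanced A M N))

namespace Tens

variable {M N M' N'}

/-- The element `x ⊗ y` of `M^t ⊗_A N`. -/
def mk (x : M) (y : N) : Tens A M N := QuotientAddGroup.mk (x ⊗ₜ[ℤ] y)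

variable {A}

theorem mk_add_left (x x' : M) (y : N) : mk A (x + x') y = mk A x y + mk A x' y := by
  simp only [mk, TensorProduct.add_tmul]; rfl

theorem mk_add_right (x : M) (y y' : N) : mk A x (y + y') = mk A x y + mk A x y' := by
  simp only [mk, TensorProduct.tmul_add]; rfl

theorem mk_balanced (a : A) (x : M) (y : N) : mk A (star a • x) y = mk A x (a • y) := by
  refine (QuotientAddGroup.eq_iff_sub_mem).2 ?_
  exact AddSubgroup.subset_closure ⟨a, x, y, rfl⟩

theorem ext {P : Type*} [AddCommGroup P] {f g : Tens A M N →+ P}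
    (h : ∀ x y, f (mk A x y) = g (mk A x y)) : f = g := by
  refine QuotientAddGroup.addMonoidHom_ext _ ?_
  ext z
  induction z using TensorProduct.induction_on with
  | zero => simp
  | tmul x y => exact h x y
  | add x y hx hy => rw [map_add, map_add, hx, hy]

/-- The homomorphism out of `M^t ⊗_A N` given by a balanced biadditive map. -/
def lift {P : Type*} [AddCommGroup P] (f : M →+ N →+ P)
    (h : ∀ (a : A) x y, f (star a • x) y = f x (a • y)) : Tens A M N →+ P :=
  QuotientAddGroup.lift (balanced A M N)
    (TensorProduct.liftAddHom f (fun r x y => by simp))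
    (by
      rw [balanced, AddSubgroup.closure_le]
      rintro _ ⟨a, x, y, rfl⟩
      simp [h])

@[simp] theorem lift_mk {P : Type*} [AddCommGroup P] (f : M →+ N →+ P)
    (h : ∀ (a : A) x y, f (star a • x) y = f x (a • y)) (x : M) (y : N) :
    lift f h (mk A x y) = f x y := by
  have hf : ∀ (r : ℤ) (m : M) (n : N), f (r • m) n = f m (r • n) := fun r m n => by simp
  exact TensorProduct.liftAddHom_tmul (R := ℤ) f hf x y

variable (A M N) in
/-- `mk` as a biadditive map. -/
def mkHom : M →+ N →+ Tens A M N :=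
  AddMonoidHom.mk' (fun x => AddMonoidHom.mk' (fun y => mk A x y) (mk_add_right x))
    (fun x x' => by ext y; exact mk_add_left x x' y)

@[simp] theorem mkHom_apply (x : M) (y : N) : mkHom A M N x y = mk A x y := rfl

/-- `f ⊗ g : M^t ⊗_A N → M'^t ⊗_A N'`. -/
def map (f : M →ₗ[A] M') (g : N →ₗ[A] N') : Tens A M N →+ Tens A M' N' :=
  lift (((mkHom A M' N').comp f.toAddMonoidHom).compr₂ (AddMonoidHom.id _) |>.compl₂
    g.toAddMonoidHom) (fun a x y => by simp [mk_balanced])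

@[simp] theorem map_mk (f : M →ₗ[A] M') (g : N →ₗ[A] N') (x : M) (y : N) :
    map f g (mk A x y) = mk A (f x) (g y) := by simp [map]

variable (A M N) in
/-- The transposition `M^t ⊗_A N → N^t ⊗_A M`, `x ⊗ y ↦ y ⊗ x`. -/
def swap : Tens A M N →+ Tens A N M :=
  lift (mkHom A N M).flip (fun a x y => by
    have := mk_balanced (A := A) (star a) y x
    simpa using this.symm)

@[simp] theorem swap_mk (x : M) (y : N) : swap A M N (mk A x y) = mk A y x := by
  rw [swap, lift_mk]; rfl

variable (A M N) in
/-- The slant map `M^t ⊗_A N → Hom_A(M^*, N)`, `x ⊗ y ↦ (f ↦ star (f x) • y)`. -/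
def slant : Tens A M N →+ (Dual A M →ₗ[A] N) :=
  lift
    (AddMonoidHom.mk' (fun x => AddMonoidHom.mk' (fun y =>
      { toFun := fun f => star (f x) • y
        map_add' := fun f g => by simp [add_smul]
        map_smul' := fun a f => by simp [mul_smul] })
      (fun y y' => by ext f; simp))
      (fun x x' => by ext y f; simp [add_smul]))
    (fun a x y => by ext f; simp [mul_smul])

@[simp] theorem slant_mk (x : M) (y : N) (f : Dual A M) :
    slant A M N (mk A x y) f = star (f x) • y := by simp [slant]

end Tens

end Modules

/-! ### Signs -/

/-- The sign `(-1)^n`. -/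
def sg (n : ℤ) : ℤ := (n.negOnePow : ℤˣ)

theorem sg_add (m n : ℤ) : sg (m + n) = sg m * sg n := by simp [sg, Int.negOnePow_add]

theorem sg_congr {m n : ℤ} (h : Even (m - n)) : sg m = sg n := by
  simp only [sg]; rw [(Int.negOnePow_eq_iff m n).2 h]

theorem sg_mul_self (n : ℤ) : sg n * sg n = 1 := by
  rw [← sg_add]; simp [sg, Int.negOnePow_even _ ⟨n, rfl⟩]

@[simp] theorem sg_zero : sg 0 = 1 := by simp [sg]

@[simp] theorem sg_one : sg 1 = -1 := by simp [sg]

@[simp] theorem sg_neg (n : ℤ) : sg (-n) = sg n := sg_congr ⟨-n, by ring⟩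

theorem sg_sub (m n : ℤ) : sg (m - n) = sg m * sg n := by rw [sub_eq_add_neg, sg_add, sg_neg]

/-! ### Chain complexes, the tensor product and the dual -/

section Complexes

variable {A : Type u} [Ring A]

/-- An `A`-module chain complex is `n`-dimensional if it consists of f.g. projective modules in
degrees `0, …, n` and is zero in the other degrees. -/
def IsStrictlyDimensional (n : ℕ) (C : ChainComplex (ModuleCat.{u} A) ℤ) : Prop :=
  (∀ r, Module.Finite A (C.X r) ∧ Module.Projective A (C.X r)) ∧
    ∀ r : ℤ, r < 0 ∨ (n : ℤ) < r → Subsingleton (C.X r)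

/-- A chain complex is finite-dimensional if it has the chain homotopy type of an `n`-dimensional
chain complex for some `n`. -/
def IsFiniteDimensional (C : ChainComplex (ModuleCat.{u} A) ℤ) : Prop :=
  ∃ (n : ℕ) (D : ChainComplex (ModuleCat.{u} A) ℤ),
    IsStrictlyDimensional n D ∧ Nonempty (HomotopyEquiv C D)

variable [StarRing A]

/-- The total abelian group `⨁_{p,q} C_p ⊗_A D_q` of the complex `C^t ⊗_A D`. -/
abbrev Tot (C D : ChainComplex (ModuleCat.{u} A) ℤ) : Type u :=
  ⨁ i : ℤ × ℤ, Tens A (C.X i.1) (D.X i.2)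

namespace Tot

variable {C D C' D' : ChainComplex (ModuleCat.{u} A) ℤ}

/-- `x ⊗ y` for `x ∈ C_p`, `y ∈ D_q`. -/
def tmul (C D : ChainComplex (ModuleCat.{u} A) ℤ) (p q : ℤ) (x : C.X p) (y : D.X q) : Tot C D :=
  DirectSum.of (fun i : ℤ × ℤ => Tens A (C.X i.1) (D.X i.2)) (p, q) (Tens.mk A x y)

/-- The subgroup `(C^t ⊗_A D)_n = ⨁_{p+q=n} C_p ⊗_A D_q` of the total group. -/
def deg (C D : ChainComplex (ModuleCat.{u} A) ℤ) (n : ℤ) : AddSubgroup (Tot C D) :=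
  AddSubgroup.closure {z | ∃ (p q : ℤ) (x : C.X p) (y : D.X q), p + q = n ∧ z = tmul C D p q x y}

/-- The homomorphism out of the total group with given components. -/
def lift {Y : Type*} [AddCommGroup Y] (f : ∀ p q : ℤ, Tens A (C.X p) (D.X q) →+ Y) : Tot C D →+ Y :=
  DirectSum.toAddMonoid fun i => f i.1 i.2

@[simp] theorem lift_tmul {Y : Type*} [AddCommGroup Y]
    (f : ∀ p q : ℤ, Tens A (C.X p) (D.X q) →+ Y) (p q : ℤ) (x : C.X p) (y : D.X q) :
    lift f (tmul C D p q x y) = f p q (Tens.mk A x y) := by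
  simp [lift, tmul]

theorem ext {Y : Type*} [AddCommGroup Y] {f g : Tot C D →+ Y}
    (h : ∀ p q x y, f (tmul C D p q x y) = g (tmul C D p q x y)) : f = g := by
  refine DirectSum.addHom_ext' fun i => Tens.ext fun x y => h i.1 i.2 x y

theorem tmul_mem_deg {n p q : ℤ} (h : p + q = n) (x : C.X p) (y : D.X q) :
    tmul C D p q x y ∈ deg C D n := AddSubgroup.subset_closure ⟨p, q, x, y, h, rfl⟩

theorem map_mem_deg {n n' : ℤ} (f : Tot C D →+ Tot C' D')
    (h : ∀ p q x y, p + q = n → f (tmul C D p q x y) ∈ deg C' D' n') {z : Tot C D}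
    (hz : z ∈ deg C D n) : f z ∈ deg C' D' n' := by
  have : deg C D n ≤ (deg C' D' n').comap f := by
    rw [deg, AddSubgroup.closure_le]
    rintro _ ⟨p, q, x, y, hpq, rfl⟩
    exact h p q x y hpq
  exact this hz

/-- The component `(p, q)` inclusion. -/
abbrev incl (C D : ChainComplex (ModuleCat.{u} A) ℤ) (p q : ℤ) :
    Tens A (C.X p) (D.X q) →+ Tot C D :=
  DirectSum.of (fun i : ℤ × ℤ => Tens A (C.X i.1) (D.X i.2)) (p, q)

/-- The differential `d (x ⊗ y) = x ⊗ d y + (-1)^q d x ⊗ y` (`y ∈ D_q`) of `C^t ⊗_A D`. -/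
def d (C D : ChainComplex (ModuleCat.{u} A) ℤ) : Tot C D →+ Tot C D :=
  lift fun p q =>
    (incl C D p (q - 1)).comp (Tens.map LinearMap.id (D.d q (q - 1)).hom) +
      sg q • (incl C D (p - 1) q).comp (Tens.map (C.d p (p - 1)).hom LinearMap.id)

theorem d_tmul (p q : ℤ) (x : C.X p) (y : D.X q) :
    d C D (tmul C D p q x y) = tmul C D p (q - 1) x ((D.d q (q - 1)).hom y) +
      sg q • tmul C D (p - 1) q ((C.d p (p - 1)).hom x) y := by
  rw [d, lift_tmul]; simp [tmul]

/-- The transposition `T (x ⊗ y) = (-1)^{pq} y ⊗ x` (`x ∈ C_p`, `y ∈ D_q`). -/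
def T (C D : ChainComplex (ModuleCat.{u} A) ℤ) : Tot C D →+ Tot D C :=
  lift fun p q => sg (p * q) • (incl D C q p).comp (Tens.swap A (C.X p) (D.X q))

theorem T_tmul (p q : ℤ) (x : C.X p) (y : D.X q) :
    T C D (tmul C D p q x y) = sg (p * q) • tmul D C q p y x := by
  rw [T, lift_tmul]; simp [tmul]

/-- The chain map `f^t ⊗ g : C^t ⊗_A D → C'^t ⊗_A D'` of chain maps `f`, `g`. -/
def map (f : C ⟶ C') (g : D ⟶ D') : Tot C D →+ Tot C' D' :=
  lift fun p q => (incl C' D' p q).comp (Tens.map (f.f p).hom (g.f q).hom)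

theorem map_tmul (f : C ⟶ C') (g : D ⟶ D') (p q : ℤ) (x : C.X p) (y : D.X q) :
    map f g (tmul C D p q x y) = tmul C' D' p q ((f.f p).hom x) ((g.f q).hom y) := by
  rw [map, lift_tmul]; simp [tmul]

end Tot

/-- The dual complex `C^{0-*}`, with `(C^{0-*})_r = (C_{-r})^*` and differential `(-1)^r d^*`. -/
def dualComplex (C : ChainComplex (ModuleCat.{u} A) ℤ) : ChainComplex (ModuleCat.{u} A) ℤ where
  X r := ModuleCat.of A (Dual A (C.X (-r)))
  d r r' := sg r • ModuleCat.ofHom (dualMap A (C.d (-r') (-r)).hom)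
  shape r r' h := by
    have : C.d (-r') (-r) = 0 := C.shape _ _ (by simp at h ⊢; omega)
    rw [this]
    ext f
    simp [dualMap_zero]
  d_comp_d' i j k _ _ := by
    rw [Preadditive.zsmul_comp, Preadditive.comp_zsmul, ← ModuleCat.ofHom_comp, ← dualMap_comp,
      ← ModuleCat.hom_comp, C.d_comp_d]
    simp [dualMap_zero]

/-- The value `u x` of `u ∈ (C^{0-*})_p = (C_{-p})^*` on `x ∈ C_{-p}`. -/
def dualEval {C : ChainComplex (ModuleCat.{u} A) ℤ} {p : ℤ} (u : (dualComplex C).X p)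
    (x : C.X (-p)) : A :=
  (show Dual A (C.X (-p)) from u) x

/-- The chain map `f^* : C^{0-*} → B^{0-*}` of a chain map `f : B → C`. -/
def dualComplexMap {B C : ChainComplex (ModuleCat.{u} A) ℤ} (f : B ⟶ C) :
    dualComplex C ⟶ dualComplex B where
  f r := ModuleCat.ofHom (dualMap A (f.f (-r)).hom)
  comm' i j _ := by
    simp only [dualComplex]
    rw [Preadditive.zsmul_comp, Preadditive.comp_zsmul, ← ModuleCat.ofHom_comp,
      ← ModuleCat.ofHom_comp, ← dualMap_comp, ← dualMap_comp, ← ModuleCat.hom_comp,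
      ← ModuleCat.hom_comp, f.comm]

namespace Tot

variable {C D C' D' : ChainComplex (ModuleCat.{u} A) ℤ}

/-- The component `(C^{0-*})_p = (C_{-p})^* → D_q` of the morphism corresponding to an element of
`C^t ⊗_A D` under the slant map `x ⊗ y ↦ (f ↦ star (f x) • y)`. -/
def slant (p q : ℤ) : Tot C D →+ ((dualComplex C).X p →ₗ[A] D.X q) :=
  (Tens.slant A (C.X (-p)) (D.X q)).comp
    (DFinsupp.evalAddMonoidHom (β := fun i : ℤ × ℤ => Tens A (C.X i.1) (D.X i.2)) (-p, q))

/-- Let `f ∈ (C^t ⊗_A D)_m`, `g ∈ (C'^t ⊗_A D')_{m'}`, regarded through the slant map as families of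
morphisms `f : (C^{0-*})_p → D_{p+m}` and `g : (C'^{0-*})_q → D'_{q+m'}`. This is the morphism
`f ⊗ g : (C^{0-*})^t ⊗_A C'^{0-*} → D^t ⊗_A D'`, `u ⊗ v ↦ (-1)^{mq} f u ⊗ g v`
(`v` of degree `q`). The sign is the one for which the differential of `f ⊗ g` is given by the
Leibniz rule; in particular `f ⊗ f` is a chain map up to sign if `f` is one. -/
def tensorMap (m m' : ℤ) (f : Tot C D) (g : Tot C' D') :
    Tot (dualComplex C) (dualComplex C') →+ Tot D D' :=
  lift fun p q => sg (m * q) • (incl D D' (p + m) (q + m')).comp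
    (Tens.map (slant p (p + m) f) (slant q (q + m') g))

theorem tensorMap_tmul (m m' : ℤ) (f : Tot C D) (g : Tot C' D') (p q : ℤ)
    (u : (dualComplex C).X p) (v : (dualComplex C').X q) :
    tensorMap m m' f g (tmul (dualComplex C) (dualComplex C') p q u v) =
      sg (m * q) • tmul D D' (p + m) (q + m') (slant p (p + m) f u)
        (slant q (q + m') g v) := by
  rw [tensorMap, lift_tmul]; simp [tmul]

theorem tmul_zsmul_left (n p q : ℤ) (x : C.X p) (y : D.X q) :
    tmul C D p q (n • x) y = n • tmul C D p q x y := by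
  rw [tmul, tmul, ← map_zsmul]
  exact congrArg _ (DFunLike.congr_fun (map_zsmul (Tens.mkHom A (C.X p) (D.X q)) n x) y)

theorem tmul_zsmul_right (n p q : ℤ) (x : C.X p) (y : D.X q) :
    tmul C D p q x (n • y) = n • tmul C D p q x y := by
  rw [tmul, tmul, ← map_zsmul]
  exact congrArg _ (map_zsmul (Tens.mkHom A (C.X p) (D.X q) x) n y)

theorem tmul_add_left (p q : ℤ) (x x' : C.X p) (y : D.X q) :
    tmul C D p q (x + x') y = tmul C D p q x y + tmul C D p q x' y := by
  rw [tmul, tmul, tmul, ← map_add, Tens.mk_add_left]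

theorem tmul_add_right (p q : ℤ) (x : C.X p) (y y' : D.X q) :
    tmul C D p q x (y + y') = tmul C D p q x y + tmul C D p q x y' := by
  rw [tmul, tmul, tmul, ← map_add, Tens.mk_add_right]

theorem tensorMap_add_left (m m' : ℤ) (f f' : Tot C D) (g : Tot C' D') :
    tensorMap m m' (f + f') g = tensorMap m m' f g + tensorMap m m' f' g := by
  refine ext fun p q u v => ?_
  simp only [tensorMap_tmul, AddMonoidHom.add_apply, map_add, LinearMap.add_apply,
    tmul_add_left, smul_add]

theorem tensorMap_add_right (m m' : ℤ) (f : Tot C D) (g g' : Tot C' D') :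
    tensorMap m m' f (g + g') = tensorMap m m' f g + tensorMap m m' f g' := by
  refine ext fun p q u v => ?_
  simp only [tensorMap_tmul, AddMonoidHom.add_apply, map_add, LinearMap.add_apply,
    tmul_add_right, smul_add]

@[simp] theorem tensorMap_zero_left (m m' : ℤ) (g : Tot C' D') :
    tensorMap m m' (0 : Tot C D) g = 0 := by
  have := tensorMap_add_left m m' (0 : Tot C D) 0 g
  simpa using this

@[simp] theorem tensorMap_zero_right (m m' : ℤ) (f : Tot C D) :
    tensorMap m m' f (0 : Tot C' D') = 0 := by
  have := tensorMap_add_right m m' f (0 : Tot C' D') 0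
  simpa using this

theorem tensorMap_neg_left (m m' : ℤ) (f : Tot C D) (g : Tot C' D') :
    tensorMap m m' (-f) g = -tensorMap m m' f g := by
  rw [eq_neg_iff_add_eq_zero, ← tensorMap_add_left]; simp

theorem tensorMap_neg_right (m m' : ℤ) (f : Tot C D) (g : Tot C' D') :
    tensorMap m m' f (-g) = -tensorMap m m' f g := by
  rw [eq_neg_iff_add_eq_zero, ← tensorMap_add_right]; simp

theorem tensorMap_mem_deg {m m' n n' : ℤ} (h : n + m + m' = n') (f : Tot C D) (g : Tot C' D')
    {z : Tot (dualComplex C) (dualComplex C')} (hz : z ∈ deg _ _ n) :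
    tensorMap m m' f g z ∈ deg D D' n' := by
  refine map_mem_deg _ (fun p q x y hpq => ?_) hz
  rw [tensorMap_tmul]
  exact zsmul_mem (tmul_mem_deg (by omega) _ _) _

theorem d_mem_deg {n n' : ℤ} (h : n' = n - 1) {z : Tot C D} (hz : z ∈ deg C D n) :
    d C D z ∈ deg C D n' := by
  refine map_mem_deg _ (fun p q x y hpq => ?_) hz
  rw [d_tmul]
  exact add_mem (tmul_mem_deg (by omega) _ _) (zsmul_mem (tmul_mem_deg (by omega) _ _) _)

theorem T_mem_deg {n : ℤ} {z : Tot C D} (hz : z ∈ deg C D n) : T C D z ∈ deg D C n := by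
  refine map_mem_deg _ (fun p q x y hpq => ?_) hz
  rw [T_tmul]
  exact zsmul_mem (tmul_mem_deg (by omega) _ _) _

theorem map_mem (f : C ⟶ C') (g : D ⟶ D') {n : ℤ} {z : Tot C D} (hz : z ∈ deg C D n) :
    map f g z ∈ deg C' D' n := by
  refine map_mem_deg _ (fun p q x y hpq => ?_) hz
  rw [map_tmul]
  exact tmul_mem_deg hpq _ _

theorem map_map {C'' D'' : ChainComplex (ModuleCat.{u} A) ℤ} (f : C ⟶ C') (g : D ⟶ D')
    (f' : C' ⟶ C'') (g' : D' ⟶ D'') (z : Tot C D) :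
    map f' g' (map f g z) = map (f ≫ f') (g ≫ g') z := by
  refine DFunLike.congr_fun (f := (map f' g').comp (map f g)) (ext fun p q x y => ?_) z
  simp [map_tmul]

theorem map_id (z : Tot C D) : map (𝟙 C) (𝟙 D) z = z := by
  refine DFunLike.congr_fun (g := AddMonoidHom.id _) (ext fun p q x y => ?_) z
  simp [map_tmul]

theorem map_zero_left (g : D ⟶ D') (z : Tot C D) : map (0 : C ⟶ C') g z = 0 := by
  refine DFunLike.congr_fun (g := (0 : Tot C D →+ Tot C' D')) (ext fun p q x y => ?_) z
  rw [map_tmul]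
  have : Tens.mk A (0 : C'.X p) ((g.f q).hom y) = 0 := by
    simpa using Tens.mk_add_left (A := A) (0 : C'.X p) 0 ((g.f q).hom y)
  simp [tmul, this]

@[simp] theorem T_T (z : Tot C D) : T D C (T C D z) = z := by
  refine DFunLike.congr_fun (f := (T D C).comp (T C D)) (g := AddMonoidHom.id _)
    (ext fun p q x y => ?_) z
  simp only [AddMonoidHom.comp_apply, T_tmul, map_zsmul, smul_smul, AddMonoidHom.id_apply]
  rw [mul_comm q p, sg_mul_self, one_smul]

theorem d_T (z : Tot C D) : d D C (T C D z) = T C D (d C D z) := by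
  refine DFunLike.congr_fun (f := (d D C).comp (T C D)) (g := (T C D).comp (d C D))
    (ext fun p q x y => ?_) z
  simp only [AddMonoidHom.comp_apply, T_tmul, d_tmul, map_zsmul, map_add, smul_add, smul_smul]
  rw [add_comm]
  congr 2
  · rw [← sg_add]; exact sg_congr ⟨p, by ring⟩
  · rw [← sg_add]; exact sg_congr ⟨0, by ring⟩

theorem T_map (f : C ⟶ C') (g : D ⟶ D') (z : Tot C D) :
    T C' D' (map f g z) = map g f (T C D z) := by
  refine DFunLike.congr_fun (f := (T C' D').comp (map f g)) (g := (map g f).comp (T C D))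
    (ext fun p q x y => ?_) z
  simp [T_tmul, map_tmul]

theorem d_map (f : C ⟶ C') (g : D ⟶ D') (z : Tot C D) :
    d C' D' (map f g z) = map f g (d C D z) := by
  refine DFunLike.congr_fun (f := (d C' D').comp (map f g)) (g := (map f g).comp (d C D))
    (ext fun p q x y => ?_) z
  simp only [AddMonoidHom.comp_apply, d_tmul, map_tmul, map_zsmul, map_add]
  have h1 := ConcreteCategory.congr_hom (f.comm p (p - 1)) x
  have h2 := ConcreteCategory.congr_hom (g.comm q (q - 1)) y
  simp only [ModuleCat.hom_comp, LinearMap.comp_apply] at h1 h2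
  rw [h1, h2]

/-- Interchange of `tensorMap` with the transposition. -/
theorem T_tensorMap (m m' : ℤ) (f : Tot C D) (g : Tot C' D')
    (z : Tot (dualComplex C) (dualComplex C')) :
    T D D' (tensorMap m m' f g z) = sg (m * m') • tensorMap m' m g f (T _ _ z) := by
  refine DFunLike.congr_fun (f := (T D D').comp (tensorMap m m' f g))
    (g := sg (m * m') • (tensorMap m' m g f).comp (T _ _)) (ext fun p q u v => ?_) z
  simp only [AddMonoidHom.comp_apply, AddMonoidHom.smul_apply, T_tmul, tensorMap_tmul, map_zsmul,
    smul_smul, ← sg_add]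
  congr 1
  exact sg_congr ⟨m * q, by ring⟩

theorem slant_tmul_same (p q : ℤ) (x : C.X (-p)) (y : D.X q) (u : (dualComplex C).X p) :
    slant p q (tmul C D (-p) q x y) u = star (dualEval u x) • y := by
  have : (DFinsupp.evalAddMonoidHom (β := fun i : ℤ × ℤ => Tens A (C.X i.1) (D.X i.2)) (-p, q))
      (tmul C D (-p) q x y) = Tens.mk A x y := by
    exact DirectSum.of_eq_same (β := fun i : ℤ × ℤ => Tens A (C.X i.1) (D.X i.2)) (-p, q)
      (Tens.mk A x y)
  change Tens.slant A (C.X (-p)) (D.X q) _ (show Dual A (C.X (-p)) from u) = _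
  rw [this, Tens.slant_mk]
  rfl

theorem slant_tmul_ne (p q : ℤ) {p' q' : ℤ} (h : p' ≠ -p ∨ q' ≠ q) (x : C.X p') (y : D.X q') :
    slant p q (tmul C D p' q' x y) = 0 := by
  have : (DFinsupp.evalAddMonoidHom (β := fun i : ℤ × ℤ => Tens A (C.X i.1) (D.X i.2)) (-p, q))
      (tmul C D p' q' x y) = 0 := by
    refine DirectSum.of_eq_of_ne (β := fun i : ℤ × ℤ => Tens A (C.X i.1) (D.X i.2)) (p', q') (-p, q)
      (Tens.mk A x y) ?_
    intro hh
    simp only [Prod.mk.injEq] at hh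
    omega
  exact (congrArg (Tens.slant A (C.X (-p)) (D.X q)) this).trans (map_zero _)

theorem dualComplex_d_apply (p p' : ℤ) (u : (dualComplex C).X p) (x : C.X (-p')) :
    dualEval (((dualComplex C).d p p').hom u) x =
      sg p • dualEval u ((C.d (-p') (-p)).hom x) := by
  have h : ((dualComplex C).d p p').hom = sg p • dualMap A (C.d (-p') (-p)).hom := by
    simp only [dualComplex, ModuleCat.hom_zsmul]
    rfl
  rw [h]
  rfl

theorem tmul_congr_left {p p' q : ℤ} (h : p' = p) (i : ℤ) (x : C.X i) (y : D.X q) :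
    tmul C D p' q ((C.d i p').hom x) y = tmul C D p q ((C.d i p).hom x) y := by
  subst h; rfl

theorem tmul_congr_right {p q q' : ℤ} (h : q' = q) (j : ℤ) (x : C.X p) (y : D.X j) :
    tmul C D p q' x ((D.d j q').hom y) = tmul C D p q x ((D.d j q).hom y) := by
  subst h; rfl

theorem d_slant (m p k l : ℤ) (hk : k = p + m) (hl : l = k - 1) (z : Tot C D)
    (u : (dualComplex C).X p) :
    (D.d k l).hom (slant p k z u) = slant p l (d C D z) u +
      sg m • slant (p - 1) l z (((dualComplex C).d p (p - 1)).hom u) := by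
  refine DFunLike.congr_fun
    (f := (D.d k l).hom.toAddMonoidHom.comp
      ((LinearMap.toAddMonoidHom'.comp (slant (C := C) (D := D) p k)).flip u))
    (g := ((LinearMap.toAddMonoidHom'.comp (slant (C := C) (D := D) p l)).flip u).comp (d C D) +
      sg m • (LinearMap.toAddMonoidHom'.comp (slant (C := C) (D := D) (p - 1) l)).flip
        (((dualComplex C).d p (p - 1)).hom u)) (ext fun i j x y => ?_) z
  change (D.d k l).hom (slant p k (tmul C D i j x y) u) = slant p l (d C D (tmul C D i j x y)) u +
      sg m • slant (p - 1) l (tmul C D i j x y) (((dualComplex C).d p (p - 1)).hom u)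
  rw [d_tmul, map_add, map_zsmul, LinearMap.add_apply, LinearMap.smul_apply]
  by_cases hi : i = -p
  · subst hi
    rw [slant_tmul_ne p l (p' := -p - 1) (Or.inl (by omega)),
      slant_tmul_ne (p - 1) l (p' := -p) (Or.inl (by omega))]
    by_cases hj : j = k
    · subst hj
      rw [slant_tmul_same, tmul_congr_right hl.symm, slant_tmul_same, map_smul]
      simp
    · rw [slant_tmul_ne p k (Or.inr hj), slant_tmul_ne p l (Or.inr (by omega))]
      simp
  · rw [slant_tmul_ne p k (Or.inl hi), slant_tmul_ne p l (p' := i) (Or.inl hi)]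
    by_cases hi' : i = -(p - 1)
    · subst hi'
      by_cases hj : j = l
      · subst hj
        rw [tmul_congr_left (show -(p - 1) - 1 = -p by ring), slant_tmul_same, slant_tmul_same]
        rw [dualComplex_d_apply, star_zsmul, smul_assoc, smul_smul, ← sg_add,
          sg_congr (m := j) (n := m + p + 1) ⟨-1, by rw [hl, hk]; ring⟩, sg_add (m + p)]
        simp
      · rw [slant_tmul_ne p l (Or.inr hj), slant_tmul_ne (p - 1) l (Or.inr hj)]
        simp
    · rw [slant_tmul_ne p l (p' := i - 1) (Or.inl (by omega)),
        slant_tmul_ne (p - 1) l (Or.inl hi')]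
      simp

theorem slant_congr_left {k k' q : ℤ} (h : k = k') (p : ℤ) (f : Tot C' C)
    (u : (dualComplex C').X p) (y : D.X q) :
    tmul C D k q (slant p k f u) y = tmul C D k' q (slant p k' f u) y := by
  subst h; rfl

theorem slant_congr_right {k k' q : ℤ} (h : k = k') (p : ℤ) (f : Tot C' D)
    (u : (dualComplex C').X p) (y : C.X q) :
    tmul C D q k y (slant p k f u) = tmul C D q k' y (slant p k' f u) := by
  subst h; rfl

/-- The Leibniz rule for `tensorMap`. -/
theorem d_tensorMap (m m' : ℤ) (f : Tot C D) (g : Tot C' D')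
    (z : Tot (dualComplex C) (dualComplex C')) :
    d D D' (tensorMap m m' f g z) = tensorMap m (m' - 1) f (d C' D' g) z +
      sg m' • tensorMap (m - 1) m' (d C D f) g z + sg (m + m') • tensorMap m m' f g (d _ _ z) := by
  refine DFunLike.congr_fun (f := (d D D').comp (tensorMap m m' f g))
    (g := tensorMap m (m' - 1) f (d C' D' g) + sg m' • tensorMap (m - 1) m' (d C D f) g +
      sg (m + m') • (tensorMap m m' f g).comp (d _ _)) (ext fun p q u v => ?_) z
  simp only [AddMonoidHom.add_apply, AddMonoidHom.comp_apply, AddMonoidHom.smul_apply,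
    tensorMap_tmul, map_zsmul, map_add, d_tmul]
  rw [d_slant m p _ _ rfl rfl, d_slant m' q _ _ rfl rfl]
  rw [slant_congr_right (show q + (m' - 1) = q + m' - 1 by ring),
    slant_congr_left (show p + (m - 1) = p + m - 1 by ring),
    slant_congr_right (show q - 1 + m' = q + m' - 1 by ring),
    slant_congr_left (show p - 1 + m = p + m - 1 by ring)]
  simp only [tmul_add_left, tmul_add_right, tmul_zsmul_left, tmul_zsmul_right, smul_add, smul_smul,
    ← sg_add]
  rw [sg_congr (m := m * q + m') (n := m + m' + m * (q - 1)) ⟨0, by ring⟩,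
    sg_congr (m := m * q + (q + m')) (n := m' + (m - 1) * q) ⟨q, by ring⟩,
    sg_congr (m := m * q + (q + m' + m)) (n := m + m' + (q + m * q)) ⟨0, by ring⟩]
  abel

theorem slant_map {C₁ D₁ : ChainComplex (ModuleCat.{u} A) ℤ} (a : C ⟶ C₁) (b : D ⟶ D₁) (p q : ℤ)
    (z : Tot C D) (u : (dualComplex C₁).X p) :
    slant p q (map a b z) u = (b.f q).hom (slant p q z (((dualComplexMap a).f p).hom u)) := by
  refine DFunLike.congr_fun
    (f := ((LinearMap.toAddMonoidHom'.comp (slant (C := C₁) (D := D₁) p q)).flip u).comp (map a b))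
    (g := (b.f q).hom.toAddMonoidHom.comp
      ((LinearMap.toAddMonoidHom'.comp (slant (C := C) (D := D) p q)).flip
        (((dualComplexMap a).f p).hom u))) (ext fun i j x y => ?_) z
  change slant p q (map a b (tmul C D i j x y)) u =
    (b.f q).hom (slant p q (tmul C D i j x y) (((dualComplexMap a).f p).hom u))
  rw [map_tmul]
  by_cases h : i ≠ -p ∨ j ≠ q
  · rw [slant_tmul_ne p q h, slant_tmul_ne p q h]
    simp
  · push Not at h
    obtain ⟨rfl, rfl⟩ := h
    rw [slant_tmul_same, slant_tmul_same, map_smul]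
    rfl

theorem tensorMap_map {C₁ D₁ C₁' D₁' : ChainComplex (ModuleCat.{u} A) ℤ} (m m' : ℤ)
    (a : C ⟶ C₁) (b : D ⟶ D₁) (a' : C' ⟶ C₁') (b' : D' ⟶ D₁') (f : Tot C D) (g : Tot C' D')
    (z : Tot (dualComplex C₁) (dualComplex C₁')) :
    tensorMap m m' (map a b f) (map a' b' g) z =
      map b b' (tensorMap m m' f g (map (dualComplexMap a) (dualComplexMap a') z)) := by
  refine DFunLike.congr_fun (f := tensorMap m m' (map a b f) (map a' b' g))
    (g := (map b b').comp ((tensorMap m m' f g).comp (map (dualComplexMap a) (dualComplexMap a'))))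
    (ext fun p q u v => ?_) z
  simp only [AddMonoidHom.comp_apply, tensorMap_tmul, map_tmul, map_zsmul, slant_map]

end Tot

/-- The cycles in `(C^t ⊗_A D)_n`. -/
def Tot.cycles (C D : ChainComplex (ModuleCat.{u} A) ℤ) (n : ℤ) : AddSubgroup (Tot C D) :=
  Tot.deg C D n ⊓ (Tot.d C D).ker

/-- The homology group `H_n(C^t ⊗_A D)`. -/
abbrev TensorHomology (C D : ChainComplex (ModuleCat.{u} A) ℤ) (n : ℤ) : Type u :=
  Tot.cycles C D n ⧸ ((Tot.deg C D (n + 1)).map (Tot.d C D)).addSubgroupOf (Tot.cycles C D n)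

/-- The class in `H_n(C^t ⊗_A D)` of a cycle. -/
def TensorHomology.mk {C D : ChainComplex (ModuleCat.{u} A) ℤ} {n : ℤ} (z : Tot.cycles C D n) :
    TensorHomology C D n := QuotientAddGroup.mk z

/-! ### Hyperquadratic and symmetric structures, bundles -/

section Tate

variable (C : ChainComplex (ModuleCat.{u} A) ℤ)

/-- The group `(Ŵ^% C)_n = Hom_{ℤ[ℤ/2]}(Ŵ, C^t ⊗_A C)_n` of families `θ_s ∈ (C^t ⊗_A C)_{n+s}`,
`s ∈ ℤ`. -/
def tateChains (n : ℤ) : AddSubgroup (ℤ → Tot C C) where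
  carrier := {θ | ∀ s, θ s ∈ Tot.deg C C (n + s)}
  add_mem' h h' s := add_mem (h s) (h' s)
  zero_mem' _ := zero_mem _
  neg_mem' h s := neg_mem (h s)

/-- The group `(W^% C)_n = Hom_{ℤ[ℤ/2]}(W, C^t ⊗_A C)_n` of families `φ_s ∈ (C^t ⊗_A C)_{n+s}`,
`s ≥ 0`, regarded as families indexed by `ℤ` which are zero for `s < 0`. With this convention the
chain map `J : W^% C → Ŵ^% C` is the inclusion. -/
def symmetricChains (n : ℤ) : AddSubgroup (ℤ → Tot C C) where
  carrier := {φ | φ ∈ tateChains C n ∧ ∀ s < 0, φ s = 0}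
  add_mem' h h' := ⟨add_mem h.1 h'.1, fun s hs => by simp [h.2 s hs, h'.2 s hs]⟩
  zero_mem' := ⟨zero_mem _, fun _ _ => rfl⟩
  neg_mem' h := ⟨neg_mem h.1, fun s hs => by simp [h.2 s hs]⟩

/-- The differential of `Ŵ^% C` (and of `W^% C`) on chains of degree `n`,
`(d θ)_s = d (θ_s) + (-1)^{n+s-1} (θ_{s-1} + (-1)^s T θ_{s-1})`. -/
def tateD (n : ℤ) : (ℤ → Tot C C) →+ (ℤ → Tot C C) :=
  AddMonoidHom.mk' (fun θ s => Tot.d C C (θ s) +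
    sg (n + s - 1) • (θ (s - 1) + sg s • Tot.T C C (θ (s - 1)))) (fun θ θ' => by
      funext s
      simp only [Pi.add_apply, map_add, smul_add]
      abel)

/-- The cycles in `(Ŵ^% C)_n`: the `n`-dimensional hyperquadratic structures on `C`. -/
def tateCycles (n : ℤ) : AddSubgroup (ℤ → Tot C C) := tateChains C n ⊓ (tateD C n).ker

/-- The cycles in `(W^% C)_n`: the `n`-dimensional symmetric structures on `C`. -/
def symmetricCycles (n : ℤ) : AddSubgroup (ℤ → Tot C C) := symmetricChains C n ⊓ (tateD C n).ker

/-- A bundle over `C` is a `0`-dimensional hyperquadratic structure on `C^{0-*}`. A chain bundle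
`(C, γ)` is a chain complex `C` together with `γ : Bundle C`. -/
abbrev Bundle : Type u := tateCycles (dualComplex C) 0

end Tate

variable {B C D C' : ChainComplex (ModuleCat.{u} A) ℤ}

theorem tateD_apply (n : ℤ) (θ : ℤ → Tot C C) (s : ℤ) :
    tateD C n θ s = Tot.d C C (θ s) +
      sg (n + s - 1) • (θ (s - 1) + sg s • Tot.T C C (θ (s - 1))) := rfl

/-- The chain map `Ŵ^% C → Ŵ^% D` (and `W^% C → W^% D`) induced by a chain map `f : C → D`. -/
def tateMap (f : C ⟶ D) : (ℤ → Tot C C) →+ (ℤ → Tot D D) :=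
  AddMonoidHom.mk' (fun θ s => Tot.map f f (θ s)) (fun θ θ' => by funext s; simp)

@[simp] theorem tateMap_apply (f : C ⟶ D) (θ : ℤ → Tot C C) (s : ℤ) :
    tateMap f θ s = Tot.map f f (θ s) := rfl

theorem tateD_tateMap (f : C ⟶ D) (n : ℤ) (θ : ℤ → Tot C C) :
    tateD D n (tateMap f θ) = tateMap f (tateD C n θ) := by
  funext s
  simp only [tateD_apply, tateMap_apply, map_add, map_zsmul, Tot.d_map, Tot.T_map]

theorem tateMap_mem_tateChains (f : C ⟶ D) {n : ℤ} {θ : ℤ → Tot C C} (h : θ ∈ tateChains C n) :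
    tateMap f θ ∈ tateChains D n := fun s => Tot.map_mem f f (h s)

theorem tateMap_mem_symmetricChains (f : C ⟶ D) {n : ℤ} {φ : ℤ → Tot C C}
    (h : φ ∈ symmetricChains C n) : tateMap f φ ∈ symmetricChains D n :=
  ⟨tateMap_mem_tateChains f h.1, fun s hs => by simp [h.2 s hs]⟩

namespace Bundle

/-- The pullback `f^* γ` of a bundle `γ` over `C` along a chain map `f : B → C`. -/
def pullback (f : B ⟶ C) : Bundle C →+ Bundle B :=
  ((tateMap (dualComplexMap f)).comp (tateCycles (dualComplex C) 0).subtype).codRestrict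
    (tateCycles (dualComplex B) 0) (fun γ => ⟨tateMap_mem_tateChains _ γ.2.1, by
      change tateD _ 0 (tateMap (dualComplexMap f) γ.1) = 0
      rw [tateD_tateMap, show tateD _ 0 γ.1 = 0 from γ.2.2, map_zero]⟩)

theorem pullback_coe (f : B ⟶ C) (γ : Bundle C) (s : ℤ) :
    (pullback f γ).1 s = Tot.map (dualComplexMap f) (dualComplexMap f) (γ.1 s) := rfl

theorem pullback_pullback (f : B ⟶ C) (g : C ⟶ D) (γ : Bundle D) :
    pullback f (pullback g γ) = pullback (f ≫ g) γ := by
  refine Subtype.ext (funext fun s => ?_)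
  rw [pullback_coe, pullback_coe, Tot.map_map]
  rfl

theorem pullback_id (γ : Bundle C) : pullback (𝟙 C) γ = γ := by
  refine Subtype.ext (funext fun s => ?_)
  rw [pullback_coe]
  exact Tot.map_id _

theorem pullback_zero (γ : Bundle C) : pullback (0 : B ⟶ C) γ = 0 := by
  refine Subtype.ext (funext fun s => ?_)
  rw [pullback_coe]
  have h : dualComplexMap (0 : B ⟶ C) = 0 := by
    ext r : 1
    exact ModuleCat.hom_ext (dualMap_zero A (B.X (-r)) (C.X (-r)))
  rw [h, Tot.map_zero_left]
  rfl

/-- The direct sum bundle `γ ⊕ γ'` over `C ⊕ C'`, the sum of the pullbacks of `γ` and `γ'` along the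
projections. -/
def directSum (γ : Bundle C) (γ' : Bundle C') : Bundle (C ⊞ C') :=
  pullback biprod.fst γ + pullback biprod.snd γ'

theorem pullback_inl (γ : Bundle C) (γ' : Bundle C') :
    pullback biprod.inl (directSum γ γ') = γ := by
  rw [directSum, map_add, pullback_pullback, pullback_pullback, biprod.inl_fst, biprod.inl_snd,
    pullback_id, pullback_zero, add_zero]

theorem pullback_inr (γ : Bundle C) (γ' : Bundle C') :
    pullback biprod.inr (directSum γ γ') = γ' := by
  rw [directSum, map_add, pullback_pullback, pullback_pullback, biprod.inr_fst, biprod.inr_snd,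
    pullback_id, pullback_zero, zero_add]

theorem directSum_eq_zero {γ : Bundle C} {γ' : Bundle C'} (h : γ = 0) (h' : γ' = 0) :
    directSum γ γ' = 0 := by rw [directSum, h, h', map_zero, map_zero, add_zero]

theorem d_apply (γ : Bundle C) (t : ℤ) :
    Tot.d _ _ (γ.1 t) = sg t • γ.1 (t - 1) + Tot.T _ _ (γ.1 (t - 1)) := by
  have h : tateD _ 0 γ.1 t = 0 := congrFun (show tateD _ 0 γ.1 = 0 from γ.2.2) t
  rw [tateD_apply, zero_add, sg_sub, sg_one, smul_add, smul_smul, mul_neg_one, neg_mul,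
    sg_mul_self] at h
  rw [eq_comm, ← sub_eq_zero, ← neg_eq_zero, ← h]
  module

end Bundle

/-! ### The operations on a bundle induced by chains of `C^t ⊗_A C` -/

section Twist

variable (n : ℤ) (γ : Bundle C)

/-- The hyperquadratic structure `f^%(S^n γ) ∈ (Ŵ^% D)_n` for `f ∈ (C^t ⊗_A D)_n`, regarded
as a morphism `C^{n-*} → D` or equivalently as a morphism `C^{0-*} → D` of degree `n`:
`f^%(S^n γ)_s = (f ⊗ f) γ_{s-n}`. -/
def twist (f : Tot C D) : ℤ → Tot D D := fun s => Tot.tensorMap n n f f (γ.1 (s - n))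

/-- The chain `(g; f, f')^%(S^n γ) ∈ (Ŵ^% D)_{n+1}` of a chain homotopy `d g = f' - f`, with
`d ((g; f, f')^%(S^n γ)) = f'^%(S^n γ) - f^%(S^n γ)`. -/
def homotopyTwist (f f' g : Tot C D) : ℤ → Tot D D := fun s =>
  Tot.tensorMap n (n + 1) f g (γ.1 (s - n)) + sg n • Tot.tensorMap (n + 1) n g f' (γ.1 (s - n)) -
    Tot.T D D (Tot.tensorMap (n + 1) (n + 1) g g (γ.1 (s - n - 1)))

/-- The chain `[f, f'](S^n γ) ∈ (Ŵ^% D)_{n+1}`, with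
`d ([f, f'](S^n γ)) = f^%(S^n γ) + f'^%(S^n γ) - (f + f')^%(S^n γ)`. -/
def sumTwist (f f' : Tot C D) : ℤ → Tot D D := fun s =>
  sg (n + 1) • Tot.T D D (Tot.tensorMap n n f f' (γ.1 (s - n + 1)))

variable {n γ}

theorem sg_eq (n : ℤ) : sg n = 1 ∨ sg n = -1 := by
  have h := sg_mul_self n
  have : (sg n - 1) * (sg n + 1) = 0 := by linear_combination h
  rcases mul_eq_zero.1 this with h | h
  · left; linarith
  · right; linarith

theorem twist_mem_tateChains (f : Tot C D) : twist n γ f ∈ tateChains D n := fun s =>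
  Tot.tensorMap_mem_deg (by ring) f f (γ.2.1 (s - n))

theorem homotopyTwist_mem_tateChains (f f' g : Tot C D) :
    homotopyTwist n γ f f' g ∈ tateChains D (n + 1) := fun s =>
  sub_mem (add_mem (Tot.tensorMap_mem_deg (by ring) f g (γ.2.1 (s - n)))
    (zsmul_mem (Tot.tensorMap_mem_deg (by ring) g f' (γ.2.1 (s - n))) _))
    (Tot.T_mem_deg (Tot.tensorMap_mem_deg (by ring) g g (γ.2.1 (s - n - 1))))

theorem sumTwist_mem_tateChains (f f' : Tot C D) :
    sumTwist n γ f f' ∈ tateChains D (n + 1) := fun s =>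
  zsmul_mem (Tot.T_mem_deg (Tot.tensorMap_mem_deg (by ring) f f' (γ.2.1 (s - n + 1)))) _

theorem tateD_twist {f : Tot C D} (hf : Tot.d C D f = 0) : tateD D n (twist n γ f) = 0 := by
  funext s
  simp only [tateD_apply, twist, Tot.d_tensorMap, hf, Tot.tensorMap_zero_left,
    Tot.tensorMap_zero_right, AddMonoidHom.zero_apply, Bundle.d_apply, map_add, map_zsmul,
    Tot.T_tensorMap, Pi.zero_apply]
  rw [show s - 1 - n = s - n - 1 by ring, sg_congr (m := n * n) (n := n) (by
    rw [← mul_sub_one]; exact Int.even_mul_pred_self n), sg_sub, sg_sub, sg_add, sg_add, sg_one]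
  rcases sg_eq n with h | h <;> rcases sg_eq s with h' | h' <;> rw [h, h'] <;> module

theorem tateD_homotopyTwist {f f' g : Tot C D} (hf : Tot.d C D f = 0) (hf' : Tot.d C D f' = 0)
    (hg : Tot.d C D g = f' - f) :
    tateD D (n + 1) (homotopyTwist n γ f f' g) = twist n γ f' - twist n γ f := by
  have e1 : sg (n * n) = sg n := sg_congr (by rw [← mul_sub_one]; exact Int.even_mul_pred_self n)
  obtain rfl : f' = f + Tot.d C D g := by rw [hg]; abel
  have hdd : Tot.d C D (Tot.d C D g) = 0 := by rwa [map_add, hf, zero_add] at hf'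
  funext s
  simp only [tateD_apply, homotopyTwist, twist, Tot.d_tensorMap, Tot.d_T, hf, hdd,
    Tot.tensorMap_zero_left, Tot.tensorMap_zero_right, AddMonoidHom.zero_apply, Bundle.d_apply,
    map_add, map_zsmul, map_sub, Tot.T_tensorMap, Pi.sub_apply, Tot.T_T, Tot.tensorMap_add_left,
    Tot.tensorMap_add_right, AddMonoidHom.add_apply]
  rw [show s - 1 - n = s - n - 1 by ring]
  simp only [add_sub_cancel_right, mul_add, add_mul, mul_one, one_mul, sg_sub, sg_add, sg_one, e1]
  rcases sg_eq n with h | h <;> rcases sg_eq s with h' | h' <;> rw [h, h'] <;> module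

theorem tateD_sumTwist {f f' : Tot C D} (hf : Tot.d C D f = 0) (hf' : Tot.d C D f' = 0) :
    tateD D (n + 1) (sumTwist n γ f f') = twist n γ f + twist n γ f' - twist n γ (f + f') := by
  have e1 : sg (n * n) = sg n := sg_congr (by rw [← mul_sub_one]; exact Int.even_mul_pred_self n)
  funext s
  simp only [tateD_apply, sumTwist, twist, Tot.d_tensorMap, Tot.d_T, hf, hf',
    Tot.tensorMap_zero_left, Tot.tensorMap_zero_right, AddMonoidHom.zero_apply, Bundle.d_apply,
    map_add, map_zsmul, Tot.T_tensorMap, Pi.sub_apply, Tot.T_T, Tot.tensorMap_add_left,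
    Tot.tensorMap_add_right, AddMonoidHom.add_apply, Pi.add_apply]
  rw [show s - 1 - n + 1 = s - n by ring, show s - n + 1 - 1 = s - n by ring]
  simp only [sg_sub, sg_add, sg_one, e1]
  rcases sg_eq n with h | h <;> rcases sg_eq s with h' | h' <;> rw [h, h'] <;> module

theorem exists_homotopyTwist_trans {f f' f'' g g' : Tot C D} (hg : Tot.d C D g = f' - f)
    (hg' : Tot.d C D g' = f'' - f') :
    ∃ η ∈ tateChains D (n + 2), homotopyTwist n γ f f'' (g + g') - homotopyTwist n γ f f' g -
      homotopyTwist n γ f' f'' g' = tateD D (n + 2) η := by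
  have e1 : sg (n * n) = sg n := sg_congr (by rw [← mul_sub_one]; exact Int.even_mul_pred_self n)
  obtain rfl : f' = f + Tot.d C D g := by rw [hg]; abel
  obtain rfl : f'' = f + Tot.d C D g + Tot.d C D g' := by rw [hg']; abel
  refine ⟨fun s => sg n • Tot.tensorMap (n + 1) (n + 1) g g' (γ.1 (s - n)), fun s =>
    zsmul_mem (Tot.tensorMap_mem_deg (by ring) _ _ (γ.2.1 (s - n))) _, ?_⟩
  funext s
  simp only [tateD_apply, homotopyTwist, Tot.d_tensorMap, Bundle.d_apply,
    map_add, map_zsmul, Tot.T_tensorMap, Pi.sub_apply, Tot.tensorMap_add_left,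
    Tot.tensorMap_add_right, AddMonoidHom.add_apply]
  rw [show s - 1 - n = s - n - 1 by ring]
  simp only [add_sub_cancel_right, mul_add, add_mul, mul_one, one_mul, sg_sub, sg_add, sg_one, e1,
    show sg 2 = 1 from sg_congr (n := 0) ⟨1, by norm_num⟩]
  rcases sg_eq n with h | h <;> rcases sg_eq s with h' | h' <;> rw [h, h'] <;> module

theorem exists_homotopyTwist_add {e f f' g : Tot C D} (he : Tot.d C D e = 0)
    (hg : Tot.d C D g = f' - f) :
    ∃ η ∈ tateChains D (n + 2), sumTwist n γ e f' - sumTwist n γ e f +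
      homotopyTwist n γ (e + f) (e + f') g - homotopyTwist n γ f f' g = tateD D (n + 2) η := by
  have e1 : sg (n * n) = sg n := sg_congr (by rw [← mul_sub_one]; exact Int.even_mul_pred_self n)
  obtain rfl : f' = f + Tot.d C D g := by rw [hg]; abel
  refine ⟨fun s => -sg n • Tot.T D D (Tot.tensorMap n (n + 1) e g (γ.1 (s - n + 1))), fun s =>
    zsmul_mem (Tot.T_mem_deg (Tot.tensorMap_mem_deg (by ring) _ _ (γ.2.1 (s - n + 1)))) _, ?_⟩
  funext s
  simp only [tateD_apply, homotopyTwist, sumTwist, Tot.d_tensorMap, Tot.d_T, Bundle.d_apply,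
    map_add, map_zsmul, Tot.T_tensorMap, Pi.sub_apply, Tot.T_T, Tot.tensorMap_add_left,
    Tot.tensorMap_add_right, AddMonoidHom.add_apply, Pi.add_apply, he, Tot.tensorMap_zero_right,
    AddMonoidHom.zero_apply]
  rw [show s - 1 - n + 1 = s - n by ring, show s - n + 1 - 1 = s - n by ring]
  simp only [add_sub_cancel_right, mul_add, add_mul, mul_one, one_mul, sg_sub, sg_add, sg_one, e1,
    show sg 2 = 1 from sg_congr (n := 0) ⟨1, by norm_num⟩]
  rcases sg_eq n with h | h <;> rcases sg_eq s with h' | h' <;> rw [h, h'] <;> module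

theorem exists_sumTwist_comm {f f' : Tot C D} (hf : Tot.d C D f = 0) (hf' : Tot.d C D f' = 0) :
    ∃ η ∈ tateChains D (n + 2), sumTwist n γ f' f - sumTwist n γ f f' = tateD D (n + 2) η := by
  have e1 : sg (n * n) = sg n := sg_congr (by rw [← mul_sub_one]; exact Int.even_mul_pred_self n)
  refine ⟨fun s => -Tot.tensorMap n n f f' (γ.1 (s - n + 2)), fun s =>
    neg_mem (Tot.tensorMap_mem_deg (by ring) _ _ (γ.2.1 (s - n + 2))), ?_⟩
  funext s
  simp only [tateD_apply, sumTwist, Tot.d_tensorMap, Bundle.d_apply, map_neg,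
    map_add, map_zsmul, Tot.T_tensorMap, Pi.sub_apply, hf, hf', Tot.tensorMap_zero_left,
    Tot.tensorMap_zero_right, AddMonoidHom.zero_apply]
  rw [show s - 1 - n + 2 = s - n + 1 by ring, show s - n + 2 - 1 = s - n + 1 by ring]
  simp only [mul_one, sg_sub, sg_add, sg_one, e1,
    show sg 2 = 1 from sg_congr (n := 0) ⟨1, by norm_num⟩]
  rcases sg_eq n with h | h <;> rcases sg_eq s with h' | h' <;> rw [h, h'] <;> module

end Twist

/-! ### Twisted quadratic groups -/

/-- An `n`-dimensional symmetric structure `(φ, θ)` on a chain bundle `(C, γ)`: an `n`-dimensional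
symmetric structure `φ` on `C` together with a chain `θ ∈ (Ŵ^% C)_{n+1}` such that
`J φ - φ_0^%(S^n γ) = d θ`. -/
@[ext] structure SymmetricStructure (γ : Bundle C) (n : ℤ) where
  φ : ℤ → Tot C C
  θ : ℤ → Tot C C
  φ_mem : φ ∈ symmetricCycles C n
  θ_mem : θ ∈ tateChains C (n + 1)
  d_θ : φ - twist n γ (φ 0) = tateD C (n + 1) θ

namespace SymmetricStructure

variable {γ : Bundle C} {n : ℤ}

theorem d_φ_zero (x : SymmetricStructure γ n) : Tot.d C C (x.φ 0) = 0 := by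
  have h := congrFun (show tateD C n x.φ = 0 from x.φ_mem.2) 0
  rw [tateD_apply, x.φ_mem.1.2 (0 - 1) (by norm_num)] at h
  simpa using h

theorem φ_zero_mem (x : SymmetricStructure γ n) : x.φ 0 ∈ Tot.deg C C n := by
  have h := x.φ_mem.1.1 0
  rwa [add_zero] at h

theorem d_zero_eq {n : ℤ} {ξ φ : ℤ → Tot C C} (hξ : ξ ∈ symmetricChains C (n + 1))
    (h : φ = tateD C (n + 1) ξ) : Tot.d C C (ξ 0) = φ 0 := by
  rw [h, tateD_apply, hξ.2 (0 - 1) (by norm_num)]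
  simp

/-- The equivalence relation on symmetric structures on `(C, γ)`: there are
`ξ ∈ (W^% C)_{n+1}` and `η ∈ (Ŵ^% C)_{n+2}` with `φ' - φ = d ξ` and
`θ' - θ - J ξ + (ξ_0; φ_0, φ'_0)^%(S^n γ) = d η`. -/
def Equivalent (x y : SymmetricStructure γ n) : Prop :=
  ∃ ξ ∈ symmetricChains C (n + 1), ∃ η ∈ tateChains C (n + 2),
    y.φ - x.φ = tateD C (n + 1) ξ ∧
      y.θ - x.θ - ξ + homotopyTwist n γ (x.φ 0) (y.φ 0) (ξ 0) = tateD C (n + 2) η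

theorem homotopyTwist_zero (f f' : Tot C C) : homotopyTwist n γ f f' 0 = 0 := by
  funext s; simp [homotopyTwist]

theorem Equivalent.refl (x : SymmetricStructure γ n) : Equivalent x x :=
  ⟨0, zero_mem _, 0, zero_mem _, by simp, by simp [homotopyTwist_zero]⟩

theorem Equivalent.trans {x y z : SymmetricStructure γ n} (h : Equivalent x y)
    (h' : Equivalent y z) : Equivalent x z := by
  obtain ⟨ξ, hξ, η, hη, h1, h2⟩ := h
  obtain ⟨ξ', hξ', η', hη', h1', h2'⟩ := h'
  obtain ⟨ρ, hρ, e⟩ := exists_homotopyTwist_trans (n := n) (γ := γ)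
    (d_zero_eq hξ h1) (d_zero_eq hξ' h1')
  refine ⟨ξ + ξ', add_mem hξ hξ', η + η' + ρ, add_mem (add_mem hη hη') hρ, ?_, ?_⟩
  · rw [map_add, ← h1, ← h1']; abel
  · rw [map_add, map_add, ← h2, ← h2', ← e, Pi.add_apply]; abel

theorem Equivalent.symm {x y : SymmetricStructure γ n} (h : Equivalent x y) : Equivalent y x := by
  obtain ⟨ξ, hξ, η, hη, h1, h2⟩ := h
  obtain ⟨ρ, hρ, e⟩ := exists_homotopyTwist_trans (n := n) (γ := γ) (f'' := x.φ 0) (g' := -ξ 0)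
    (d_zero_eq hξ h1) (by rw [map_neg, d_zero_eq hξ h1]; simp)
  rw [add_neg_cancel, homotopyTwist_zero] at e
  refine ⟨-ξ, neg_mem hξ, -η - ρ, sub_mem (neg_mem hη) hρ, ?_, ?_⟩
  · rw [map_neg, ← h1]; abel
  · rw [map_sub, map_neg, ← h2, ← e, Pi.neg_apply]; abel

variable (γ n) in
/-- Equivalence of symmetric structures on `(C, γ)`, as a setoid. -/
instance setoid : Setoid (SymmetricStructure γ n) :=
  ⟨Equivalent, Equivalent.refl, Equivalent.symm, Equivalent.trans⟩

instance : Zero (SymmetricStructure γ n) :=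
  ⟨⟨0, 0, zero_mem _, zero_mem _, by funext s; simp [twist]⟩⟩

/-- The sum `(φ + φ', θ + θ' + [φ_0, φ'_0](S^n γ))`. -/
instance : Add (SymmetricStructure γ n) :=
  ⟨fun x y => ⟨x.φ + y.φ, x.θ + y.θ + sumTwist n γ (x.φ 0) (y.φ 0), add_mem x.φ_mem y.φ_mem,
    add_mem (add_mem x.θ_mem y.θ_mem) (sumTwist_mem_tateChains _ _), by
      rw [map_add, map_add, ← x.d_θ, ← y.d_θ, tateD_sumTwist x.d_φ_zero y.d_φ_zero, Pi.add_apply]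
      abel⟩⟩

instance : Neg (SymmetricStructure γ n) :=
  ⟨fun x => ⟨-x.φ, -x.θ + sumTwist n γ (x.φ 0) (x.φ 0), neg_mem x.φ_mem,
    add_mem (neg_mem x.θ_mem) (sumTwist_mem_tateChains _ _), by
      have h : twist n γ (-x.φ 0) = twist n γ (x.φ 0) := by
        funext s; simp [twist, Tot.tensorMap_neg_left, Tot.tensorMap_neg_right]
      have h' : twist n γ (x.φ 0 + x.φ 0) = 4 • twist n γ (x.φ 0) := by
        funext s
        simp only [twist, Tot.tensorMap_add_left, Tot.tensorMap_add_right, AddMonoidHom.add_apply,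
          Pi.smul_apply]
        abel
      rw [map_add, map_neg, ← x.d_θ, tateD_sumTwist x.d_φ_zero x.d_φ_zero, Pi.neg_apply, h, h']
      abel⟩⟩

@[simp] theorem zero_φ : (0 : SymmetricStructure γ n).φ = 0 := rfl
@[simp] theorem zero_θ : (0 : SymmetricStructure γ n).θ = 0 := rfl
@[simp] theorem add_φ (x y : SymmetricStructure γ n) : (x + y).φ = x.φ + y.φ := rfl
theorem add_θ (x y : SymmetricStructure γ n) :
    (x + y).θ = x.θ + y.θ + sumTwist n γ (x.φ 0) (y.φ 0) := rfl
@[simp] theorem neg_φ (x : SymmetricStructure γ n) : (-x).φ = -x.φ := rfl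
theorem neg_θ (x : SymmetricStructure γ n) :
    (-x).θ = -x.θ + sumTwist n γ (x.φ 0) (x.φ 0) := rfl

theorem sumTwist_add_left (f f' g : Tot C C) :
    sumTwist n γ (f + f') g = sumTwist n γ f g + sumTwist n γ f' g := by
  funext s; simp [sumTwist, Tot.tensorMap_add_left]

theorem sumTwist_add_right (f g g' : Tot C C) :
    sumTwist n γ f (g + g') = sumTwist n γ f g + sumTwist n γ f g' := by
  funext s; simp [sumTwist, Tot.tensorMap_add_right]

@[simp] theorem sumTwist_zero_left (g : Tot C C) : sumTwist n γ 0 g = 0 := by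
  funext s; simp [sumTwist]

@[simp] theorem sumTwist_zero_right (g : Tot C C) : sumTwist n γ g 0 = 0 := by
  funext s; simp [sumTwist]

theorem sumTwist_neg_left (f g : Tot C C) : sumTwist n γ (-f) g = -sumTwist n γ f g := by
  funext s; simp [sumTwist, Tot.tensorMap_neg_left]

theorem equivalent_add_comm (x y : SymmetricStructure γ n) : x + y ≈ y + x := by
  obtain ⟨η, hη, e⟩ := exists_sumTwist_comm (n := n) (γ := γ) x.d_φ_zero y.d_φ_zero
  refine ⟨0, zero_mem _, η, hη, ?_, ?_⟩
  · rw [add_φ, add_φ, map_zero]; abel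
  · rw [Pi.zero_apply, homotopyTwist_zero, ← e, add_θ, add_θ]; abel

theorem equivalent_add_left (z : SymmetricStructure γ n) {x y : SymmetricStructure γ n}
    (h : x ≈ y) : z + x ≈ z + y := by
  obtain ⟨ξ, hξ, η, hη, h1, h2⟩ := h
  obtain ⟨ρ, hρ, e⟩ := exists_homotopyTwist_add (n := n) (γ := γ) z.d_φ_zero (d_zero_eq hξ h1)
  refine ⟨ξ, hξ, η + ρ, add_mem hη hρ, ?_, ?_⟩
  · rw [← h1, add_φ, add_φ]; abel
  · rw [map_add, ← h2, ← e, add_θ, add_θ, add_φ, add_φ, Pi.add_apply, Pi.add_apply]; abel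

theorem equivalent_add {x x' y y' : SymmetricStructure γ n} (h : x ≈ x') (h' : y ≈ y') :
    x + y ≈ x' + y' :=
  calc
    x + y ≈ x + y' := equivalent_add_left x h'
    _ ≈ y' + x := equivalent_add_comm _ _
    _ ≈ y' + x' := equivalent_add_left y' h
    _ ≈ x' + y' := equivalent_add_comm _ _

theorem add_assoc' (x y z : SymmetricStructure γ n) : x + y + z = x + (y + z) := by
  ext1
  · simp only [add_φ, add_assoc]
  · simp only [add_θ, add_φ, Pi.add_apply, sumTwist_add_left, sumTwist_add_right]; abel

theorem zero_add' (x : SymmetricStructure γ n) : 0 + x = x := by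
  ext1
  · simp
  · simp [add_θ]

theorem neg_add' (x : SymmetricStructure γ n) : -x + x = 0 := by
  ext1
  · simp
  · simp [add_θ, neg_θ, sumTwist_neg_left]

end SymmetricStructure

/-- The twisted quadratic group `Q_n(C, γ)` of equivalence classes of `n`-dimensional symmetric
structures on the chain bundle `(C, γ)`. -/
def TwistedQ (γ : Bundle C) (n : ℤ) : Type u := Quotient (SymmetricStructure.setoid γ n)

namespace TwistedQ

variable {γ : Bundle C} {n : ℤ}

/-- The class in `Q_n(C, γ)` of a symmetric structure on `(C, γ)`. -/
def mk (x : SymmetricStructure γ n) : TwistedQ γ n := Quotient.mk _ x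

instance : Zero (TwistedQ γ n) := ⟨mk 0⟩

instance : Add (TwistedQ γ n) :=
  ⟨Quotient.map₂ (· + ·) fun _ _ h _ _ h' => SymmetricStructure.equivalent_add h h'⟩

theorem mk_add (x y : SymmetricStructure γ n) : mk (x + y) = mk x + mk y := rfl

instance : Neg (TwistedQ γ n) :=
  ⟨Quotient.map (- ·) fun x y h => by
    have h1 : -x + (x + -y) ≈ -x + (y + -y) := SymmetricStructure.equivalent_add_left _
      (SymmetricStructure.equivalent_add h (Setoid.refl _))
    have h2 : -x + (y + -y) ≈ -x + (-y + y) :=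
      SymmetricStructure.equivalent_add_left _ (SymmetricStructure.equivalent_add_comm _ _)
    have h3 := SymmetricStructure.equivalent_add_comm (-x) 0
    rw [← SymmetricStructure.add_assoc', SymmetricStructure.neg_add',
      SymmetricStructure.zero_add'] at h1
    rw [SymmetricStructure.neg_add'] at h2
    rw [SymmetricStructure.zero_add'] at h3
    exact Setoid.symm (Setoid.trans h1 (Setoid.trans h2 h3))⟩

instance : AddCommGroup (TwistedQ γ n) where
  add_assoc := by
    rintro ⟨x⟩ ⟨y⟩ ⟨z⟩
    exact congrArg mk (SymmetricStructure.add_assoc' x y z)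
  zero_add := by
    rintro ⟨x⟩
    exact congrArg mk (SymmetricStructure.zero_add' x)
  add_zero := by
    rintro ⟨x⟩
    exact (Quotient.sound (SymmetricStructure.equivalent_add_comm x 0)).trans
      (congrArg mk (SymmetricStructure.zero_add' x))
  nsmul := nsmulRec
  zsmul := zsmulRec
  neg_add_cancel := by
    rintro ⟨x⟩
    exact congrArg mk (SymmetricStructure.neg_add' x)
  add_comm := by
    rintro ⟨x⟩ ⟨y⟩
    exact Quotient.sound (SymmetricStructure.equivalent_add_comm x y)

end TwistedQ

namespace SymmetricStructure

/-- The symmetric structure `(f^% φ, f^% θ)` on `(D, δ)` induced from one on `(C, γ)` by a chain map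
`f : C → D` with `f^* δ = γ`, i.e. by the map of chain bundles `(f, 0) : (C, γ) → (D, δ)`. -/
def push {n : ℤ} {γ : Bundle C} {δ : Bundle D} (f : C ⟶ D) (hf : Bundle.pullback f δ = γ)
    (x : SymmetricStructure γ n) : SymmetricStructure δ n where
  φ := tateMap f x.φ
  θ := tateMap f x.θ
  φ_mem := ⟨tateMap_mem_symmetricChains f x.φ_mem.1, by
    change tateD D n (tateMap f x.φ) = 0
    rw [tateD_tateMap, show tateD C n x.φ = 0 from x.φ_mem.2, map_zero]⟩
  θ_mem := tateMap_mem_tateChains f x.θ_mem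
  d_θ := by
    rw [tateD_tateMap, ← x.d_θ, map_sub]
    congr 1
    funext s
    simp only [twist, tateMap_apply, Tot.tensorMap_map, ← hf, Bundle.pullback_coe]

/-- The symmetric structure `(0, θ)` on `(C, γ)` given by an `(n+1)`-dimensional hyperquadratic
structure `θ` on `C`. -/
def ofTate {n : ℤ} (γ : Bundle C) (θ : tateCycles C (n + 1)) : SymmetricStructure γ n where
  φ := 0
  θ := θ.1
  φ_mem := zero_mem _
  θ_mem := θ.2.1
  d_θ := by
    rw [show tateD C (n + 1) θ.1 = 0 from θ.2.2]
    funext s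
    simp [twist]

end SymmetricStructure

/-- The hyperquadratic structure `f^%(S^n γ)` on `D` for a cycle `f ∈ (C^t ⊗_A D)_n`. -/
def twistCycle {n : ℤ} (γ : Bundle C) (f : Tot.cycles C D n) : tateCycles D n :=
  ⟨twist n γ f.1, twist_mem_tateChains _, tateD_twist f.2.2⟩

/-- The transpose `T f ∈ (D^t ⊗_A C)_n` of a cycle `f ∈ (C^t ⊗_A D)_n`, i.e. the dual
`f^* : D^{n-*} → C` of the chain map `f : C^{n-*} → D`. -/
def transposeCycle {n : ℤ} (f : Tot.cycles C D n) : Tot.cycles D C n :=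
  ⟨Tot.T C D f.1, Tot.T_mem_deg f.2.1, by
    change Tot.d D C (Tot.T C D f.1) = 0
    rw [Tot.d_T, show Tot.d C D f.1 = 0 from f.2.2, map_zero]⟩

/-- The cycle `(f ⊗ g) φ_0 ∈ (D^t ⊗_A D')_n` for a symmetric structure `(φ, θ)` on `(C, γ)` and chain
maps `f : C → D`, `g : C → D'`. -/
def SymmetricStructure.zeroCycle {n : ℤ} {γ : Bundle C} {D' : ChainComplex (ModuleCat.{u} A) ℤ}
    (f : C ⟶ D) (g : C ⟶ D') (x : SymmetricStructure γ n) : Tot.cycles D D' n :=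
  ⟨Tot.map f g (x.φ 0), Tot.map_mem f g x.φ_zero_mem, by
    change Tot.d D D' (Tot.map f g (x.φ 0)) = 0
    rw [Tot.d_map, x.d_φ_zero, map_zero]⟩

/-! ### Quadratic structures -/

section Quadratic

variable (C) in
/-- The group `(W_% C)_n = (W ⊗_{ℤ[ℤ/2]} (C^t ⊗_A C))_n` of families `ψ_s ∈ (C^t ⊗_A C)_{n-s}`, `s ≥ 0`,
with only finitely many non-zero members. -/
def quadraticChains (n : ℤ) : AddSubgroup (ℕ → Tot C C) where
  carrier := {ψ | (∀ s : ℕ, ψ s ∈ Tot.deg C C (n - s)) ∧ (Function.support ψ).Finite}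
  add_mem' h h' := ⟨fun s => add_mem (h.1 s) (h'.1 s),
    (h.2.union h'.2).subset (Function.support_add _ _)⟩
  zero_mem' := ⟨fun _ => zero_mem _, by simp⟩
  neg_mem' h := ⟨fun s => neg_mem (h.1 s), by simpa using h.2⟩

variable (C) in
/-- The differential of `W_% C` on chains of degree `n`,
`(d ψ)_s = d (ψ_s) + (-1)^{n-s-1} (ψ_{s+1} + (-1)^{s+1} T ψ_{s+1})`. -/
def quadraticD (n : ℤ) : (ℕ → Tot C C) →+ (ℕ → Tot C C) :=
  AddMonoidHom.mk' (fun ψ s => Tot.d C C (ψ s) +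
    sg (n - s - 1) • (ψ (s + 1) + sg (s + 1) • Tot.T C C (ψ (s + 1)))) (fun ψ ψ' => by
      funext s
      simp only [Pi.add_apply, map_add, smul_add]
      abel)

variable (C) in
/-- The cycles in `(W_% C)_n`: the `n`-dimensional quadratic structures on `C`. -/
def quadraticCycles (n : ℤ) : AddSubgroup (ℕ → Tot C C) := quadraticChains C n ⊓ (quadraticD C n).ker

variable (C) in
/-- The quadratic group `Q_n(C) = H_n(W_% C)`. -/
abbrev QuadraticQ (n : ℤ) : Type u :=
  quadraticCycles C n ⧸
    ((quadraticChains C (n + 1)).map (quadraticD C (n + 1))).addSubgroupOf (quadraticCycles C n)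

/-- The class in `Q_n(C)` of a quadratic structure. -/
def QuadraticQ.mk {n : ℤ} (ψ : quadraticCycles C n) : QuadraticQ C n := QuotientAddGroup.mk ψ

variable {n : ℤ}

theorem quadraticCycles_eq (ψ : quadraticCycles C n) (s : ℕ) :
    Tot.d C C (ψ.1 s) +
      sg (n - s - 1) • (ψ.1 (s + 1) + sg (s + 1) • Tot.T C C (ψ.1 (s + 1))) = 0 :=
  congrFun (show quadraticD C n ψ.1 = 0 from ψ.2.2) s

/-- The quadratic structure `f_% ψ` on `D` induced from one on `C` by a chain map `f : C → D`. -/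
def quadraticPush (f : C ⟶ D) (ψ : quadraticCycles C n) : quadraticCycles D n :=
  ⟨fun s => Tot.map f f (ψ.1 s), ⟨fun s => Tot.map_mem f f (ψ.2.1.1 s),
    ψ.2.1.2.subset (fun s hs h => hs (by simp [h]))⟩, by
      change quadraticD D n _ = 0
      funext s
      have h := congrArg (Tot.map f f) (quadraticCycles_eq ψ s)
      simpa [quadraticD, Tot.d_map, Tot.T_map] using h⟩

theorem d_symmetrize (ψ : quadraticCycles C n) :
    Tot.d C C (ψ.1 0 + Tot.T C C (ψ.1 0)) = 0 := by
  have h := quadraticCycles_eq ψ 0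
  rw [Nat.cast_zero, zero_add, zero_add, sg_one] at h
  rw [map_add, Tot.d_T, eq_neg_of_add_eq_zero_left h]
  simp

theorem symmetrize_mem (ψ : quadraticCycles C n) :
    ψ.1 0 + Tot.T C C (ψ.1 0) ∈ Tot.deg C C n := by
  have h : ψ.1 0 ∈ Tot.deg C C n := by simpa using ψ.2.1.1 0
  exact add_mem h (Tot.T_mem_deg h)

/-- The cycle `(f ⊗ g) (1 + T) ψ_0 ∈ (D^t ⊗_A D')_n` for a quadratic structure `ψ` on `C` and chain maps
`f : C → D`, `g : C → D'`. -/
def quadraticZeroCycle {D' : ChainComplex (ModuleCat.{u} A) ℤ} (f : C ⟶ D) (g : C ⟶ D')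
    (ψ : quadraticCycles C n) : Tot.cycles D D' n :=
  ⟨Tot.map f g (ψ.1 0 + Tot.T C C (ψ.1 0)), Tot.map_mem f g (symmetrize_mem ψ), by
    change Tot.d D D' _ = 0
    rw [Tot.d_map, d_symmetrize, map_zero]⟩

/-- The symmetric structure `((1 + T) ψ, θ)` on `(C, 0)` given by a quadratic structure `ψ` on `C`, with
`((1 + T) ψ)_0 = (1 + T) ψ_0`, `((1 + T) ψ)_s = 0` for `s ≠ 0`, and `θ_s = (-1)^n ψ_{-s-1}` for
`s ≤ -1`, `θ_s = 0` for `s ≥ 0`. -/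
def SymmetricStructure.ofQuadratic {γ : Bundle C} (hγ : γ = 0) (ψ : quadraticCycles C n) :
    SymmetricStructure γ n where
  φ s := if s = 0 then ψ.1 0 + Tot.T C C (ψ.1 0) else 0
  θ s := if s ≤ -1 then sg n • ψ.1 (-s - 1).toNat else 0
  φ_mem := by
    refine ⟨⟨fun s => ?_, fun s hs => if_neg hs.ne⟩, ?_⟩
    · by_cases hs : s = 0
      · simpa [hs] using symmetrize_mem ψ
      · simp [hs, zero_mem]
    · change tateD C n _ = 0
      funext s
      rw [tateD_apply]
      by_cases hs : s = 0
      · subst hs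
        simpa using d_symmetrize ψ
      · by_cases hs1 : s = 1
        · subst hs1
          simp
        · simp [hs, sub_eq_zero, hs1]
  θ_mem s := by
    by_cases hs : s ≤ -1
    · have h := ψ.2.1.1 (-s - 1).toNat
      rw [Int.toNat_of_nonneg (by omega), show n - (-s - 1) = n + 1 + s by ring] at h
      simpa only [if_pos hs] using zsmul_mem h _
    · simp [hs, zero_mem]
  d_θ := by
    subst hγ
    have h0 : twist n (0 : Bundle C) (if (0 : ℤ) = 0 then ψ.1 0 + Tot.T C C (ψ.1 0) else 0) = 0 := by
      funext s
      exact map_zero _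
    rw [h0, sub_zero]
    funext s
    rw [tateD_apply]
    rcases lt_trichotomy s 0 with hs | hs | hs
    · obtain ⟨t, rfl⟩ : ∃ t : ℕ, s = -t - 1 := ⟨(-s - 1).toNat, by omega⟩
      have h := congrArg (sg n • ·) (quadraticCycles_eq ψ t)
      rw [if_neg (by omega), if_pos (by omega), if_pos (by omega),
        show (-(-(t : ℤ) - 1) - 1).toNat = t by omega,
        show (-(-(t : ℤ) - 1 - 1) - 1).toNat = t + 1 by omega]
      simp only [smul_zero] at h
      rw [← h, map_zsmul, map_zsmul, sg_congr (m := n + 1 + (-t - 1) - 1) (n := n - t - 1) ⟨0, by ring⟩,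
        sg_congr (m := -t - 1) (n := t + 1) ⟨-t - 1, by ring⟩]
      module
    · subst hs
      have e : sg (n + 1 + 0 - 1) = sg n := by congr 1; ring
      rw [if_pos rfl, if_neg (by norm_num), if_pos (by norm_num), e, map_zsmul]
      have h := sg_mul_self n
      rw [show (-(0 - 1 : ℤ) - 1).toNat = 0 from rfl, sg_zero, map_zero, zero_add, one_smul,
        ← smul_add, smul_smul, h, one_smul]
    · rw [if_neg (by omega), if_neg (by omega), if_neg (by omega)]
      simp

end Quadratic

end Complexes

end

end ChainBundle

open ChainBundle

/-! The sequence measures how far the functor `Q_n(-, -)` is from being additive. Write an element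
of `(C ⊕ C')^t ⊗ (C ⊕ C')` as a 2 by 2 block matrix. Two facts about cross effects decide
everything.

In the hyperquadratic complex the cross effect is acyclic: the two off-diagonal blocks of a cycle
are exchanged by `T`, and a shift of the index `s` contracts them
(`swap_add_swap_mem_tateBoundaries`). A hyperquadratic cycle on the sum is therefore a boundary as
soon as its two diagonal blocks are (`mem_tateBoundaries_of_tateMap_mem`). The same contraction
gives `2 = 0` on hyperquadratic homology, and a similar one shows that `T` acts there as the
identity. These relations absorb all sign discrepancies, including the signs in `k_*`.

In the symmetric complex the contraction has to stop at `s = 0`. What survives of the off-diagonal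
part is `(1 + T)` of one off-diagonal block of `φ_0`, placed at index `0`
(`exists_swap_add_swap_eq`). This is why `H_n(C^t ⊗ C')` is the third term.

The twist by `γ ⊕ γ'` is read off in blocks (`tateMap_twist_directSum`): if `φ_0` has diagonal
blocks `a`, `a'` and off-diagonal blocks `f`, `f^*`, the diagonal blocks of its twist are `a^% γ +
(f^*)^% γ'` and `f^% γ + a'^% γ'`. The mixed terms are the components of `k_*`. Exactness thus
becomes a comparison of diagonal blocks modulo boundaries; off-diagonal data are built from `F + T
F` at index `0`, where `F` is `f` placed in the upper right block.

For zero bundles `k_*` vanishes, so the long sequence breaks up. Identifying `Q_n(D)` with `Q_n(D,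
0)` requires finitely supported families. A finite-dimensional complex has a self-map `p`, homotopic
to the identity and zero in negative degrees, so `p ⊗ p` kills negative total degrees; an explicit
homotopy from `p^%` to the identity (`tateD_tateHomotopy`) replaces arbitrary families by finitely
supported ones. The splitting places `f` in the index `0` term of a quadratic structure. -/

namespace ChainBundle

noncomputable section

section

variable {A : Type u} [Ring A] [StarRing A]
variable {B C D C' D' : ChainComplex (ModuleCat.{u} A) ℤ}

/-! ### Block decomposition of tensors over a direct sum. -/

namespace Tot

theorem map_add_left (f f' : C ⟶ C') (g : D ⟶ D') (z : Tot C D) :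
    map (f + f') g z = map f g z + map f' g z := by
  refine DFunLike.congr_fun (g := map f g + map f' g) (ext fun p q x y => ?_) z
  simp [map_tmul, tmul_add_left]

theorem map_add_right (f : C ⟶ C') (g g' : D ⟶ D') (z : Tot C D) :
    map f (g + g') z = map f g z + map f g' z := by
  refine DFunLike.congr_fun (g := map f g + map f g') (ext fun p q x y => ?_) z
  simp [map_tmul, tmul_add_right]

theorem map_zero_right (f : C ⟶ C') (z : Tot C D) : map f (0 : D ⟶ D') z = 0 := by
  have h := map_add_right f (0 : D ⟶ D') 0 z
  simpa using h

/-- The four blocks of an element of `(C ⊕ C')^t ⊗_A (C ⊕ C')`. -/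
theorem eq_sum_blocks (z : Tot (C ⊞ C') (C ⊞ C')) :
    z = map biprod.inl biprod.inl (map biprod.fst biprod.fst z) +
      map biprod.inr biprod.inr (map biprod.snd biprod.snd z) +
      (map (biprod.fst ≫ biprod.inl) (biprod.snd ≫ biprod.inr) z +
        map (biprod.snd ≫ biprod.inr) (biprod.fst ≫ biprod.inl) z) := by
  conv_lhs => rw [← map_id z, ← biprod.total, map_add_left, map_add_right, map_add_right]
  rw [map_map, map_map]
  abel

/-- Since `γ ⊕ γ'` is a sum of pullbacks along the projections, naturality of `tensorMap` pairs the
`C`-components of `F` and `G` through `γ` and the `C'`-components through `γ'`, with no mixed terms.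
-/
theorem map_tensorMap_directSum (γ : Bundle C) (γ' : Bundle C') (m m' : ℤ) (b b' : D ⟶ D')
    (F G : Tot (C ⊞ C') D) (t : ℤ) :
    map b b' (tensorMap m m' F G ((γ.directSum γ').1 t)) =
      tensorMap m m' (map biprod.fst b F) (map biprod.fst b' G) (γ.1 t) +
        tensorMap m m' (map biprod.snd b F) (map biprod.snd b' G) (γ'.1 t) := by
  rw [tensorMap_map, tensorMap_map, ← Bundle.pullback_coe, ← Bundle.pullback_coe, ← map_add,
    ← map_add]
  rfl

end Tot

/-! ### Boundaries of hyperquadratic structures -/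

variable (C) in
/-- The boundaries in `(Ŵ^% C)_m`. -/
def tateBoundaries (m : ℤ) : AddSubgroup (ℤ → Tot C C) :=
  (tateChains C (m + 1)).map (tateD C (m + 1))

theorem mem_tateBoundaries {m k : ℤ} (h : k = m + 1) {θ : ℤ → Tot C C} :
    θ ∈ tateBoundaries C m ↔ ∃ η ∈ tateChains C k, θ = tateD C k η := by
  subst h
  exact ⟨fun ⟨η, hη, e⟩ => ⟨η, hη, e.symm⟩, fun ⟨η, hη, e⟩ => ⟨η, hη, e.symm⟩⟩

theorem tateMap_mem_tateBoundaries (f : C ⟶ D) {m : ℤ} {θ : ℤ → Tot C C}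
    (h : θ ∈ tateBoundaries C m) : tateMap f θ ∈ tateBoundaries D m := by
  obtain ⟨η, hη, rfl⟩ := h
  exact ⟨tateMap f η, tateMap_mem_tateChains f hη, tateD_tateMap f _ η⟩

theorem d_eq_of_tateD_eq_zero {m : ℤ} {θ : ℤ → Tot C C} (h : tateD C m θ = 0) (s : ℤ) :
    Tot.d C C (θ (s + 1)) = -sg (m + s) • (θ s - sg s • Tot.T C C (θ s)) := by
  have h := congrFun h (s + 1)
  rw [tateD_apply, add_sub_cancel_right, sg_add s, sg_one, show m + (s + 1) - 1 = m + s by ring,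
    Pi.zero_apply] at h
  rw [eq_neg_of_add_eq_zero_left h]
  module

/-- The cross effect of the hyperquadratic complex is acyclic. The bounding chain transposes the
entry of index `s + 1` and applies `e ⊗ e'`; its two contributions to the differential leave exactly
the two mixed terms. -/
theorem swap_add_swap_mem_tateBoundaries (e e' : C ⟶ D) {m : ℤ} {θ : ℤ → Tot C C}
    (hθ : θ ∈ tateCycles C m) :
    (fun s => Tot.map e e' (θ s) + Tot.map e' e (θ s)) ∈ tateBoundaries D m := by
  refine (mem_tateBoundaries rfl).2 ⟨fun s => sg m • Tot.map e e' (Tot.T C C (θ (s + 1))),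
    fun s => zsmul_mem (Tot.map_mem _ _ (Tot.T_mem_deg ?_)) _, ?_⟩
  · rw [show m + 1 + s = m + (s + 1) by ring]
    exact hθ.1 (s + 1)
  · funext s
    simp only [tateD_apply, map_zsmul, Tot.d_map, Tot.d_T, Tot.T_map, Tot.T_T, sub_add_cancel,
      d_eq_of_tateD_eq_zero hθ.2, map_sub]
    simp only [sg_sub, sg_add, sg_one]
    rcases sg_eq m with h | h <;> rcases sg_eq s with h' | h' <;> rw [h, h'] <;> module

/-- Hyperquadratic homology has exponent `2`: this is the cross effect for `e = e' = 1`. -/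
theorem add_self_mem_tateBoundaries {m : ℤ} {θ : ℤ → Tot C C} (hθ : θ ∈ tateCycles C m) :
    θ + θ ∈ tateBoundaries C m := by
  have h := swap_add_swap_mem_tateBoundaries (𝟙 C) (𝟙 C) hθ
  simp only [Tot.map_id] at h
  exact h

/-- Entrywise `T` is the identity on hyperquadratic homology. -/
theorem sub_T_mem_tateBoundaries {m : ℤ} {θ : ℤ → Tot C C} (hθ : θ ∈ tateCycles C m) :
    (θ - fun s => Tot.T C C (θ s)) ∈ tateBoundaries C m := by
  have hc : ∀ s, θ (s + 1) ∈ Tot.deg C C (m + 1 + s) := fun s => by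
    rw [show m + 1 + s = m + (s + 1) by ring]
    exact hθ.1 (s + 1)
  -- A witness supported on even indices: at even `s` only `d (η_s)` contributes, at odd `s` only
  -- `η_{s-1} - T η_{s-1}`, and both equal `θ_s - T θ_s`.
  refine (mem_tateBoundaries rfl).2 ⟨fun s => if Even s then -sg m • θ (s + 1) else 0,
    fun s => ?_, ?_⟩
  · by_cases h : Even s
    · simpa only [if_pos h] using zsmul_mem (hc s) _
    · simp [h, zero_mem]
  · funext s
    simp only [tateD_apply, Pi.sub_apply]
    by_cases h : Even s
    · have h1 : ¬ Even (s - 1) := by simpa [Int.even_sub] using h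
      have h2 : sg s = 1 := by rw [sg_congr (n := 0) (by simpa using h), sg_zero]
      rw [if_pos h, if_neg h1, map_zsmul, d_eq_of_tateD_eq_zero hθ.2, sg_add, h2]
      simp only [map_zero]
      rcases sg_eq m with h | h <;> rw [h] <;> module
    · have h1 : Even (s - 1) := by
        rw [Int.not_even_iff_odd] at h
        exact h.sub_odd odd_one
      have h2 : sg s = -1 := by rw [← sg_one, sg_congr h1]
      rw [if_neg h, if_pos h1, map_zero, sub_add_cancel, map_zsmul, sg_sub, sg_add, sg_add, h2,
        sg_one]
      rcases sg_eq m with h | h <;> rw [h] <;> module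

/-- Additivity of hyperquadratic homology: the off-diagonal blocks of a cycle bound automatically,
so only the diagonal blocks have to be checked. -/
theorem mem_tateBoundaries_of_tateMap_mem {m : ℤ} {θ : ℤ → Tot (C ⊞ C') (C ⊞ C')}
    (hθ : θ ∈ tateCycles _ m) (h : tateMap biprod.fst θ ∈ tateBoundaries C m)
    (h' : tateMap biprod.snd θ ∈ tateBoundaries C' m) : θ ∈ tateBoundaries _ m := by
  have e := swap_add_swap_mem_tateBoundaries (biprod.fst ≫ biprod.inl : C ⊞ C' ⟶ C ⊞ C')
    (biprod.snd ≫ biprod.inr) hθ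
  convert add_mem (add_mem (tateMap_mem_tateBoundaries biprod.inl h)
    (tateMap_mem_tateBoundaries biprod.inr h')) e using 1
  funext s
  exact Tot.eq_sum_blocks (θ s)

/-! ### Symmetric structures -/

/-- The only other entry that could appear is at index `1`, where it is `± (w - T w) = 0`. -/
theorem tateD_single (n : ℤ) (w : Tot C C) (hw : Tot.T C C w = w) :
    tateD C n (Pi.single 0 w) = Pi.single 0 (Tot.d C C w) := by
  funext s
  rw [tateD_apply]
  rcases eq_or_ne s 0 with rfl | h
  · simp
  · rw [Pi.single_eq_of_ne h, Pi.single_eq_of_ne h]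
    rcases eq_or_ne s 1 with rfl | h1
    · simp [hw]
    · rw [Pi.single_eq_of_ne (show s - 1 ≠ 0 by omega)]
      simp

theorem single_mem_symmetricChains {n : ℤ} {w : Tot C C} (hw : w ∈ Tot.deg C C n) :
    (Pi.single 0 w : ℤ → Tot C C) ∈ symmetricChains C n := by
  refine ⟨fun s => ?_, fun s hs => Pi.single_eq_of_ne hs.ne _⟩
  rcases eq_or_ne s 0 with rfl | h
  · simpa using hw
  · rw [Pi.single_eq_of_ne h]
    exact zero_mem _

/-- The contraction of the hyperquadratic cross effect, cut off below index `0`. At `s = 0` the term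
coming from index `-1` is missing, which leaves the symmetrized block of `φ_0` as the defect. -/
theorem exists_swap_add_swap_eq (e e' : C ⟶ D) {n : ℤ} {φ : ℤ → Tot C C}
    (hφ : φ ∈ symmetricCycles C n) :
    ∃ ξ ∈ symmetricChains D (n + 1), tateD D (n + 1) ξ =
      (fun s => Tot.map e e' (φ s) + Tot.map e' e (φ s)) -
        Pi.single 0 (Tot.map e e' (φ 0) + Tot.T D D (Tot.map e e' (φ 0))) := by
  have hc : ∀ s, φ (s + 1) ∈ Tot.deg C C (n + 1 + s) := fun s => by
    rw [show n + 1 + s = n + (s + 1) by ring]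
    exact hφ.1.1 (s + 1)
  refine ⟨fun s => if 0 ≤ s then sg n • Tot.map e' e (Tot.T C C (φ (s + 1))) else 0,
    ⟨fun s => ?_, fun s hs => if_neg (by omega)⟩, ?_⟩
  · by_cases h : 0 ≤ s
    · simpa only [if_pos h] using zsmul_mem (Tot.map_mem _ _ (Tot.T_mem_deg (hc s))) _
    · simp [h, zero_mem]
  · funext s
    rw [tateD_apply, Pi.sub_apply]
    rcases lt_trichotomy s 0 with h | rfl | h
    · rw [if_neg (by omega), if_neg (by omega), Pi.single_eq_of_ne h.ne, hφ.1.2 s h]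
      simp
    · rw [if_pos le_rfl, if_neg (by omega), Pi.single_eq_same]
      simp only [map_zsmul, Tot.d_map, Tot.d_T, d_eq_of_tateD_eq_zero hφ.2, map_sub, Tot.T_T,
        Tot.T_map, sg_zero, sg_add, map_zero]
      rcases sg_eq n with h | h <;> rw [h] <;> module
    · rw [if_pos h.le, if_pos (by omega), Pi.single_eq_of_ne h.ne']
      simp only [map_zsmul, Tot.d_map, Tot.d_T, Tot.T_map, Tot.T_T, sub_add_cancel,
        d_eq_of_tateD_eq_zero hφ.2, map_sub]
      simp only [sg_sub, sg_add, sg_one]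
      rcases sg_eq n with h | h <;> rcases sg_eq s with h' | h' <;> rw [h, h'] <;> module

/-! ### The operations on a direct sum of bundles -/

theorem twist_mem_tateCycles {n : ℤ} (γ : Bundle C) {f : Tot C D} (hf : Tot.d C D f = 0) :
    twist n γ f ∈ tateCycles D n := ⟨twist_mem_tateChains f, tateD_twist hf⟩

theorem twist_sub_twist_mem_tateBoundaries {n : ℤ} (γ : Bundle C) {f f' g : Tot C D}
    (hf : Tot.d C D f = 0) (hf' : Tot.d C D f' = 0) (hg : Tot.d C D g = f' - f) :
    twist n γ f' - twist n γ f ∈ tateBoundaries D n :=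
  ⟨_, homotopyTwist_mem_tateChains f f' g, tateD_homotopyTwist hf hf' hg⟩

theorem homotopyTwist_zero_zero (n : ℤ) (γ : Bundle C) (g : Tot C D) :
    homotopyTwist n γ 0 0 g = -fun s => Tot.T D D (twist (n + 1) γ g s) := by
  funext s
  simp [homotopyTwist, twist, sub_sub]

/-- A cycle `g` of degree `n + 1` is a homotopy from `0` to `0`, for which the homotopy term is `-T
(g^% γ)`. As `T` acts trivially on homology, it cancels `g^% γ`. -/
theorem twist_add_homotopyTwist_mem_tateBoundaries {n : ℤ} (γ : Bundle C) {g : Tot C D}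
    (hg : Tot.d C D g = 0) :
    twist (n + 1) γ g + homotopyTwist n γ 0 0 g ∈ tateBoundaries D (n + 1) := by
  rw [homotopyTwist_zero_zero, ← sub_eq_add_neg]
  exact sub_T_mem_tateBoundaries (twist_mem_tateCycles γ hg)

@[simp] theorem twist_zero_right (n : ℤ) (γ : Bundle C) : twist n γ (0 : Tot C D) = 0 := by
  funext s; simp [twist]

theorem twist_zero_left (n : ℤ) (f : Tot C D) : twist n 0 f = 0 := by
  funext s; exact map_zero _

variable (n : ℤ) (γ : Bundle C) (γ' : Bundle C')

/-- For `b` a projection this gives the diagonal blocks of the twist. Each one involves both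
bundles: a diagonal block of `F` twisted by one, an off-diagonal block by the other. -/
theorem tateMap_twist_directSum (b : C ⊞ C' ⟶ D) (F : Tot (C ⊞ C') (C ⊞ C')) :
    tateMap b (twist n (γ.directSum γ') F) =
      twist n γ (Tot.map biprod.fst b F) + twist n γ' (Tot.map biprod.snd b F) := by
  funext s
  exact Tot.map_tensorMap_directSum γ γ' n n b b F F _

theorem tateMap_homotopyTwist_directSum (b : C ⊞ C' ⟶ D) (F F' G : Tot (C ⊞ C') (C ⊞ C')) :
    tateMap b (homotopyTwist n (γ.directSum γ') F F' G) =
      homotopyTwist n γ (Tot.map biprod.fst b F) (Tot.map biprod.fst b F')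
        (Tot.map biprod.fst b G) +
      homotopyTwist n γ' (Tot.map biprod.snd b F) (Tot.map biprod.snd b F')
        (Tot.map biprod.snd b G) := by
  funext s
  simp only [tateMap_apply, homotopyTwist, map_sub, map_add, map_zsmul, ← Tot.T_map,
    Tot.map_tensorMap_directSum, Pi.add_apply]
  module

/-- One argument has no `C'`-component and the other no `C`-component, and `γ ⊕ γ'` does not pair
these. Consequently the sum of structures coming from the two summands needs no correction term. -/
theorem sumTwist_directSum (f : Tot C C) (f' : Tot C' C') :
    sumTwist n (γ.directSum γ') (Tot.map biprod.inl biprod.inl f)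
      (Tot.map biprod.inr biprod.inr f') = 0 := by
  funext s
  have h := Tot.map_tensorMap_directSum γ γ' n n (𝟙 _) (𝟙 _) (Tot.map biprod.inl biprod.inl f)
      (Tot.map biprod.inr biprod.inr f') (s - n + 1)
  simp only [Tot.map_map, Tot.map_id, biprod.inl_snd, biprod.inr_fst, Tot.map_zero_left,
    Tot.tensorMap_zero_left, Tot.tensorMap_zero_right, AddMonoidHom.zero_apply, add_zero] at h
  simp [sumTwist, h]

end

section

variable {A : Type u} [Ring A] [StarRing A]
variable {B C D C' D' : ChainComplex (ModuleCat.{u} A) ℤ}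

/-! ### Functoriality of the twisted quadratic groups. -/

theorem tateMap_homotopyTwist {γ : Bundle C} {δ : Bundle D} (n : ℤ) (f : C ⟶ D)
    (hf : Bundle.pullback f δ = γ) (a b c : Tot C C) :
    tateMap f (homotopyTwist n γ a b c) =
      homotopyTwist n δ (Tot.map f f a) (Tot.map f f b) (Tot.map f f c) := by
  funext s
  simp only [homotopyTwist, tateMap_apply, Tot.tensorMap_map, ← hf, Bundle.pullback_coe, map_sub,
    map_add, map_zsmul, Tot.T_map]

theorem tateMap_sumTwist {γ : Bundle C} {δ : Bundle D} (n : ℤ) (f : C ⟶ D)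
    (hf : Bundle.pullback f δ = γ) (a b : Tot C C) :
    tateMap f (sumTwist n γ a b) = sumTwist n δ (Tot.map f f a) (Tot.map f f b) := by
  funext s
  simp only [sumTwist, tateMap_apply, Tot.tensorMap_map, ← hf, Bundle.pullback_coe, map_zsmul,
    Tot.T_map]

/-- The index `1` entry of the differential, solved for `ξ_0 - T ξ_0`. It makes `ξ_0` symmetric up
to a homotopy `ξ_1`. -/
theorem sub_T_eq_of_symmetric {m : ℤ} {ξ : ℤ → Tot C C} :
    ξ 0 - Tot.T C C (ξ 0) = sg m • (tateD C m ξ 1 - Tot.d C C (ξ 1)) := by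
  rw [tateD_apply, add_sub_cancel_left, smul_smul, add_sub_cancel_right, sg_mul_self, one_smul,
    sub_self, sg_one, neg_one_smul, sub_eq_add_neg]

namespace TwistedQ

variable {γ : Bundle C} {n : ℤ}

theorem mk_eq_mk {x y : SymmetricStructure γ n} : mk x = mk y ↔
    ∃ ξ ∈ symmetricChains C (n + 1), y.φ - x.φ = tateD C (n + 1) ξ ∧
      y.θ - x.θ - ξ + homotopyTwist n γ (x.φ 0) (y.φ 0) (ξ 0) ∈ tateBoundaries C (n + 1) := by
  refine Quotient.eq.trans ⟨?_, ?_⟩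
  · rintro ⟨ξ, hξ, η, hη, h1, h2⟩
    exact ⟨ξ, hξ, h1, (mem_tateBoundaries (by ring)).2 ⟨η, hη, h2⟩⟩
  · rintro ⟨ξ, hξ, h1, h2⟩
    obtain ⟨η, hη, h2⟩ := (mem_tateBoundaries (k := n + 2) (by ring)).1 h2
    exact ⟨ξ, hξ, η, hη, h1, h2⟩

theorem mk_eq_of_φ_eq {x y : SymmetricStructure γ n} (h : x.φ = y.φ)
    (h' : y.θ - x.θ ∈ tateBoundaries C (n + 1)) : mk x = mk y := by
  refine mk_eq_mk.2 ⟨0, zero_mem _, by simp [h], ?_⟩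
  rw [Pi.zero_apply, SymmetricStructure.homotopyTwist_zero]
  simpa using h'

theorem mk_surjective : Function.Surjective (mk : SymmetricStructure γ n → TwistedQ γ n) :=
  Quotient.mk_surjective

theorem mk_zero : mk (0 : SymmetricStructure γ n) = 0 := rfl

/-- The homomorphism induced by a chain map which is covered by a map of chain bundles. -/
def pushHom {δ : Bundle D} (f : C ⟶ D) (hf : Bundle.pullback f δ = γ) :
    TwistedQ γ n →+ TwistedQ δ n :=
  AddMonoidHom.mk' (Quotient.lift (fun x : SymmetricStructure γ n => mk (x.push f hf)) (by
    intro x y h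
    obtain ⟨ξ, hξ, h1, h2⟩ := mk_eq_mk.1 (Quotient.sound h : mk x = mk y)
    refine mk_eq_mk.2 ⟨tateMap f ξ, tateMap_mem_symmetricChains f hξ, ?_, ?_⟩
    · rw [tateD_tateMap, ← h1, map_sub]; rfl
    · convert tateMap_mem_tateBoundaries f h2 using 1
      rw [map_add, map_sub, map_sub, tateMap_homotopyTwist n f hf]; rfl)) (by
    rintro ⟨x⟩ ⟨y⟩
    refine congrArg mk (SymmetricStructure.ext ?_ ?_)
    · exact map_add (tateMap f) _ _
    · refine (map_add (tateMap f) _ _).trans ?_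
      rw [map_add, tateMap_sumTwist n f hf]
      rfl)

variable (γ n) in
/-- The homomorphism `θ ↦ (0, θ)` from hyperquadratic structures to the twisted quadratic group. -/
def ofTateHom : tateCycles C (n + 1) →+ TwistedQ γ n :=
  AddMonoidHom.mk' (fun θ => mk (SymmetricStructure.ofTate γ θ)) fun θ θ' => by
    refine congrArg mk (SymmetricStructure.ext ?_ ?_)
    · exact (add_zero _).symm
    · rw [SymmetricStructure.add_θ]
      change θ.1 + θ'.1 = θ.1 + θ'.1 + sumTwist n γ 0 _
      rw [SymmetricStructure.sumTwist_zero_left, add_zero]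

theorem ofTateHom_apply (θ : tateCycles C (n + 1)) :
    ofTateHom γ n θ = mk (SymmetricStructure.ofTate γ θ) := rfl

theorem ofTateHom_eq {θ θ' : tateCycles C (n + 1)} (h : θ'.1 - θ.1 ∈ tateBoundaries C (n + 1)) :
    ofTateHom γ n θ = ofTateHom γ n θ' := mk_eq_of_φ_eq rfl h

variable (n) in
/-- The homomorphism `f ↦ (0, f^%(S^{n+1} γ))` from `H_{n+1}(C^t ⊗_A D)` to `Q_n(D, δ)`. -/
def twistHom (γ : Bundle C) (δ : Bundle D) : TensorHomology C D (n + 1) →+ TwistedQ δ n :=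
  QuotientAddGroup.lift _
    (AddMonoidHom.mk' (fun f : Tot.cycles C D (n + 1) => ofTateHom δ n (twistCycle γ f))
      fun f g => by
        rw [← map_add]
        -- The twist is quadratic in `f`; its deviation from additivity is the boundary of
        -- `sumTwist`, so it disappears in the target group.
        exact ofTateHom_eq ⟨_, sumTwist_mem_tateChains (γ := γ) f.1 g.1,
          tateD_sumTwist f.2.2 g.2.2⟩)
    (by
      rintro ⟨f, hf⟩ ⟨g, -, hg⟩
      change ofTateHom δ n (twistCycle γ ⟨f, hf⟩) = 0
      rw [← map_zero (ofTateHom δ n), eq_comm]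
      refine ofTateHom_eq ?_
      change twist (n + 1) γ f - 0 ∈ _
      -- If `f = d g`, then `g` is a homotopy from `0` to `f`.
      have h := twist_sub_twist_mem_tateBoundaries (n := n + 1) γ (map_zero _) hf.2
        (hg.trans (sub_zero f).symm)
      rwa [twist_zero_right] at h)

end TwistedQ

variable (C D) in
/-- The isomorphism `T` of `H_n(C^t ⊗_A D)` onto `H_n(D^t ⊗_A C)`, as a homomorphism. -/
def TensorHomology.transpose (n : ℤ) : TensorHomology C D n →+ TensorHomology D C n :=
  QuotientAddGroup.map _ _ (AddMonoidHom.mk' (transposeCycle (C := C) (D := D) (n := n))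
    fun f g => Subtype.ext (map_add (Tot.T C D) f.1 g.1)) (by
    rintro f ⟨g, hg, h⟩
    exact ⟨Tot.T C D g, Tot.T_mem_deg hg, (Tot.d_T g).trans (congrArg _ h)⟩)

theorem TensorHomology.mk_surjective {n : ℤ} :
    Function.Surjective (mk : Tot.cycles C D n → TensorHomology C D n) :=
  QuotientAddGroup.mk_surjective

theorem TensorHomology.mk_eq_zero {n : ℤ} {f : Tot.cycles C D n} :
    mk f = 0 ↔ ∃ g ∈ Tot.deg C D (n + 1), Tot.d C D g = f.1 :=
  QuotientAddGroup.eq_zero_iff f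

/-! ### The homomorphisms of the exact sequence -/

section Sequence

variable (γ : Bundle C) (γ' : Bundle C') (n : ℤ)

/-- The homomorphism `i_*`. -/
def inclHom : TwistedQ γ n × TwistedQ γ' n →+ TwistedQ (γ.directSum γ') n :=
  (TwistedQ.pushHom biprod.inl (Bundle.pullback_inl γ γ')).coprod
    (TwistedQ.pushHom biprod.inr (Bundle.pullback_inr γ γ'))

/-- The homomorphism `j_*`. -/
def crossHom : TwistedQ (γ.directSum γ') n →+ TensorHomology C C' n :=
  AddMonoidHom.mk' (Quotient.lift (fun y : SymmetricStructure (γ.directSum γ') n =>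
      TensorHomology.mk (y.zeroCycle biprod.fst biprod.snd)) (by
    rintro x y ⟨ξ, hξ, -, -, h, -⟩
    refine (QuotientAddGroup.eq).2 ⟨Tot.map biprod.fst biprod.snd (ξ 0), Tot.map_mem _ _ ?_, ?_⟩
    · simpa using hξ.1 0
    · rw [Tot.d_map, SymmetricStructure.d_zero_eq hξ h, Pi.sub_apply, map_sub, sub_eq_neg_add]
      rfl)) (by
    rintro ⟨x⟩ ⟨y⟩
    exact congrArg TensorHomology.mk (Subtype.ext (map_add (Tot.map _ _) (x.φ 0) (y.φ 0))))

/-- The homomorphism `k_*`. -/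
def connectingHom : TensorHomology C C' (n + 1) →+ TwistedQ γ n × TwistedQ γ' n :=
  ((TwistedQ.twistHom n γ' γ).comp (TensorHomology.transpose C C' (n + 1))).prod
    (-TwistedQ.twistHom n γ γ')

variable {γ γ' n}

theorem inclHom_mk (x : SymmetricStructure γ n) (x' : SymmetricStructure γ' n) :
    inclHom γ γ' n (TwistedQ.mk x, TwistedQ.mk x') =
      TwistedQ.mk (x.push biprod.inl (Bundle.pullback_inl γ γ')) +
        TwistedQ.mk (x'.push biprod.inr (Bundle.pullback_inr γ γ')) := rfl

theorem crossHom_mk (y : SymmetricStructure (γ.directSum γ') n) :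
    crossHom γ γ' n (TwistedQ.mk y) = TensorHomology.mk (y.zeroCycle biprod.fst biprod.snd) := rfl

theorem connectingHom_mk (f : Tot.cycles C C' (n + 1)) :
    connectingHom γ γ' n (TensorHomology.mk f) =
      (TwistedQ.mk (SymmetricStructure.ofTate γ (twistCycle γ' (transposeCycle f))),
        TwistedQ.mk (SymmetricStructure.ofTate γ' (-twistCycle γ f))) :=
  Prod.ext rfl (map_neg (TwistedQ.ofTateHom γ' n) (twistCycle γ f)).symm

theorem push_add_push_φ (x : SymmetricStructure γ n) (x' : SymmetricStructure γ' n) :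
    (x.push biprod.inl (Bundle.pullback_inl γ γ') +
      x'.push biprod.inr (Bundle.pullback_inr γ γ')).φ =
      tateMap biprod.inl x.φ + tateMap biprod.inr x'.φ := rfl

theorem push_add_push_θ (x : SymmetricStructure γ n) (x' : SymmetricStructure γ' n) :
    (x.push biprod.inl (Bundle.pullback_inl γ γ') +
      x'.push biprod.inr (Bundle.pullback_inr γ γ')).θ =
      tateMap biprod.inl x.θ + tateMap biprod.inr x'.θ := by
  refine Eq.trans ?_ (add_zero _)
  rw [← sumTwist_directSum n γ γ' (x.φ 0) (x'.φ 0)]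
  rfl

theorem tateMap_fst_add (θ : ℤ → Tot C C) (θ' : ℤ → Tot C' C') :
    tateMap biprod.fst (tateMap (biprod.inl : C ⟶ C ⊞ C') θ + tateMap biprod.inr θ') = θ := by
  funext s
  simp [Tot.map_map, Tot.map_id, Tot.map_zero_left]

theorem tateMap_snd_add (θ : ℤ → Tot C C) (θ' : ℤ → Tot C' C') :
    tateMap biprod.snd (tateMap (biprod.inl : C ⟶ C ⊞ C') θ + tateMap biprod.inr θ') = θ' := by
  funext s
  simp [Tot.map_map, Tot.map_id, Tot.map_zero_left]

end Sequence

end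

section

variable {A : Type u} [Ring A] [StarRing A]
variable {C D C' : ChainComplex (ModuleCat.{u} A) ℤ}
variable {γ : Bundle C} {γ' : Bundle C'} {n : ℤ}

/-! ### Exactness at the three places. -/

theorem SymmetricStructure.d_θ_mem {x : SymmetricStructure γ n} :
    x.φ - twist n γ (x.φ 0) ∈ tateBoundaries C n := ⟨x.θ, x.θ_mem, x.d_θ.symm⟩

/-- The symmetric structure obtained from `(φ, θ)` by adding the boundary of `ξ` to `φ`. -/
theorem TwistedQ.exists_mk_eq (x : SymmetricStructure γ n) {ξ : ℤ → Tot C C}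
    (hξ : ξ ∈ symmetricChains C (n + 1)) (hξ' : tateD C (n + 1) ξ ∈ symmetricCycles C n) :
    ∃ y : SymmetricStructure γ n, TwistedQ.mk y = TwistedQ.mk x ∧
      y.φ = x.φ + tateD C (n + 1) ξ := by
  have h0 : Tot.d C C (ξ 0) = tateD C (n + 1) ξ 0 := SymmetricStructure.d_zero_eq hξ rfl
  have hy := add_mem x.φ_mem hξ'
  have hd : Tot.d C C ((x.φ + tateD C (n + 1) ξ) 0) = 0 := by
    have h := congrFun (show tateD C n (x.φ + tateD C (n + 1) ξ) = 0 from hy.2) 0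
    rw [tateD_apply, hy.1.2 (0 - 1) (by norm_num)] at h
    simpa using h
  refine ⟨⟨x.φ + tateD C (n + 1) ξ,
    x.θ + ξ - homotopyTwist n γ (x.φ 0) ((x.φ + tateD C (n + 1) ξ) 0) (ξ 0), hy,
    sub_mem (add_mem x.θ_mem hξ.1) (homotopyTwist_mem_tateChains _ _ _), ?_⟩, Eq.symm ?_, rfl⟩
  · rw [map_sub, map_add, ← x.d_θ, tateD_homotopyTwist x.d_φ_zero hd]
    · abel
    · rw [h0, Pi.add_apply, add_sub_cancel_left]
  · refine TwistedQ.mk_eq_mk.2 ⟨ξ, hξ, add_sub_cancel_left _ _, ?_⟩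
    have e : x.θ + ξ - homotopyTwist n γ (x.φ 0) ((x.φ + tateD C (n + 1) ξ) 0) (ξ 0) - x.θ - ξ +
        homotopyTwist n γ (x.φ 0) ((x.φ + tateD C (n + 1) ξ) 0) (ξ 0) = 0 := by abel
    exact e ▸ zero_mem _

theorem TwistedQ.ofTateHom_eq_mk {x : SymmetricStructure γ n} {θ : tateCycles C (n + 1)} :
    ofTateHom γ n θ = mk x ↔ ∃ ξ ∈ symmetricChains C (n + 1), x.φ = tateD C (n + 1) ξ ∧
      x.θ - θ.1 - ξ + homotopyTwist n γ 0 (x.φ 0) (ξ 0) ∈ tateBoundaries C (n + 1) := by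
  rw [ofTateHom_apply, mk_eq_mk]
  refine exists_congr fun ξ => and_congr_right fun _ => and_congr_left fun _ => ?_
  exact iff_of_eq (congrArg (· = _) (sub_zero x.φ))

/-- The vanishing of the class of `(0, θ)`. -/
theorem TwistedQ.ofTateHom_eq_zero {θ : tateCycles C (n + 1)} :
    ofTateHom γ n θ = 0 ↔ ∃ ξ ∈ symmetricCycles C (n + 1),
      θ.1 + ξ - homotopyTwist n γ 0 0 (ξ 0) ∈ tateBoundaries C (n + 1) := by
  rw [← mk_zero, ofTateHom_eq_mk]
  constructor
  · rintro ⟨ξ, hξ, h, h'⟩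
    refine ⟨ξ, ⟨hξ, h.symm⟩, ?_⟩
    convert neg_mem h' using 1
    rw [SymmetricStructure.zero_φ, SymmetricStructure.zero_θ, Pi.zero_apply]
    abel
  · rintro ⟨ξ, ⟨hξ, h⟩, h'⟩
    refine ⟨ξ, hξ, h.symm, ?_⟩
    convert neg_mem h' using 1
    rw [SymmetricStructure.zero_φ, SymmetricStructure.zero_θ, Pi.zero_apply]
    abel

/-- The off-diagonal blocks of `ξ_0` are transposes of each other only up to the boundary of a block
of `ξ_1`. The twist does not see the difference up to boundaries, so `k_*` may be computed from
either block. -/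
theorem twist_T_sub_twist_mem_tateBoundaries {m : ℤ} {ξ : ℤ → Tot (C ⊞ C') (C ⊞ C')}
    (h0 : Tot.map biprod.fst biprod.snd (Tot.d _ _ (ξ 0)) = 0)
    (h0' : Tot.map biprod.snd biprod.fst (Tot.d _ _ (ξ 0)) = 0)
    (h : Tot.map biprod.snd biprod.fst (tateD _ m ξ 1) = 0) :
    twist m γ' (Tot.T C C' (Tot.map biprod.fst biprod.snd (ξ 0))) -
      twist m γ' (Tot.map biprod.snd biprod.fst (ξ 0)) ∈ tateBoundaries C m := by
  refine twist_sub_twist_mem_tateBoundaries γ'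
    (g := sg m • Tot.map biprod.snd biprod.fst (ξ 1)) ?_ ?_ ?_
  · rw [Tot.d_map, h0']
  · rw [Tot.d_T, Tot.d_map, h0, map_zero]
  · have hT := congrArg (Tot.map (biprod.snd : C ⊞ C' ⟶ C') (biprod.fst : C ⊞ C' ⟶ C))
      (sub_T_eq_of_symmetric (m := m) (ξ := ξ))
    rw [map_zsmul, map_sub, map_sub, h] at hT
    rw [Tot.T_map, ← neg_sub, hT, map_zsmul, Tot.d_map]
    module

/-- If the off-diagonal block of `φ_0` bounds, the whole off-diagonal part of `φ` bounds in the
symmetric complex. The class then has a block-diagonal representative, and its diagonal blocks give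
the preimage. -/
theorem exact_inclHom_crossHom (γ : Bundle C) (γ' : Bundle C') (n : ℤ) :
    Function.Exact (inclHom γ γ' n) (crossHom γ γ' n) := by
  intro q
  constructor
  · obtain ⟨y, rfl⟩ := TwistedQ.mk_surjective q
    intro h
    obtain ⟨g, hg, hgd⟩ := TensorHomology.mk_eq_zero.1 h
    have hG : Tot.map (biprod.inl : C ⟶ C ⊞ C') (biprod.inr : C' ⟶ C ⊞ C') g ∈
        Tot.deg _ _ (n + 1) := Tot.map_mem _ _ hg
    obtain ⟨ξ, hξ, hξd⟩ := exists_swap_add_swap_eq (biprod.fst ≫ biprod.inl : C ⊞ C' ⟶ C ⊞ C')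
      (biprod.snd ≫ biprod.inr) y.φ_mem
    set G := Tot.map (biprod.inl : C ⟶ C ⊞ C') (biprod.inr : C' ⟶ C ⊞ C') g with hGdef
    have hGd : Tot.d _ _ G = Tot.map (biprod.fst ≫ biprod.inl) (biprod.snd ≫ biprod.inr)
        (y.φ 0) := by
      rw [hGdef, Tot.d_map, hgd, ← Tot.map_map]
      rfl
    -- Here `ξ` bounds the off-diagonal part of `φ` except for its symmetrized block at index `0`,
    -- which `G + T G` bounds. Subtracting both makes `φ` block-diagonal.
    have hζd : tateD _ (n + 1) (-(ξ + Pi.single 0 (G + Tot.T _ _ G))) =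
        tateMap biprod.inl (tateMap biprod.fst y.φ) +
          tateMap biprod.inr (tateMap biprod.snd y.φ) - y.φ := by
      rw [map_neg, map_add, hξd, tateD_single _ _ (by rw [map_add, Tot.T_T, add_comm]), map_add,
        Tot.d_T, hGd, sub_add_cancel]
      funext s
      simp only [Pi.neg_apply, Pi.sub_apply, Pi.add_apply, tateMap_apply]
      conv_rhs => rw [sub_eq_add_neg]; arg 2; rw [Tot.eq_sum_blocks (y.φ s)]
      abel
    have hcyc : ∀ {E : ChainComplex (ModuleCat.{u} A) ℤ} (f : C ⊞ C' ⟶ E),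
        tateMap f y.φ ∈ symmetricCycles E n := fun f =>
      ⟨tateMap_mem_symmetricChains f y.φ_mem.1, (tateD_tateMap f n y.φ).trans (by
        rw [show tateD _ n y.φ = 0 from y.φ_mem.2, map_zero])⟩
    have hcyc' : tateMap biprod.inl (tateMap biprod.fst y.φ) +
        tateMap biprod.inr (tateMap biprod.snd y.φ) ∈ symmetricCycles (C ⊞ C') n := by
      have h1 := hcyc (biprod.fst ≫ biprod.inl : C ⊞ C' ⟶ C ⊞ C')
      have h2 := hcyc (biprod.snd ≫ biprod.inr : C ⊞ C' ⟶ C ⊞ C')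
      convert add_mem h1 h2 using 1
      funext s
      simp [Tot.map_map]
    obtain ⟨z, hz, hzφ⟩ := TwistedQ.exists_mk_eq y
      (neg_mem (add_mem hξ (single_mem_symmetricChains (add_mem hG (Tot.T_mem_deg hG)))))
      (hζd ▸ sub_mem hcyc' y.φ_mem)
    rw [hζd, add_sub_cancel] at hzφ
    have hz1 : tateMap biprod.fst z.φ = tateMap biprod.fst y.φ := by
      rw [hzφ, tateMap_fst_add]
    have hz2 : tateMap biprod.snd z.φ = tateMap biprod.snd y.φ := by
      rw [hzφ, tateMap_snd_add]
    have hz3 : Tot.map biprod.snd biprod.fst (z.φ 0) = 0 := by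
      rw [hzφ]
      simp [Tot.map_map, Tot.map_zero_left, Tot.map_zero_right]
    have hz4 : Tot.map biprod.fst biprod.snd (z.φ 0) = 0 := by
      rw [hzφ]
      simp [Tot.map_map, Tot.map_zero_left, Tot.map_zero_right]
    -- The projection is a structure on `(C, γ)` because the off-diagonal block of `z.φ 0` vanishes,
    -- and with it the contribution of `γ'` to this diagonal block of the twist.
    let x : SymmetricStructure γ n := ⟨tateMap biprod.fst z.φ, tateMap biprod.fst z.θ,
      hz1 ▸ hcyc biprod.fst, tateMap_mem_tateChains _ z.θ_mem, by
        rw [tateD_tateMap, ← z.d_θ, map_sub, tateMap_twist_directSum, hz3, twist_zero_right,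
          add_zero]
        rfl⟩
    let x' : SymmetricStructure γ' n := ⟨tateMap biprod.snd z.φ, tateMap biprod.snd z.θ,
      hz2 ▸ hcyc biprod.snd, tateMap_mem_tateChains _ z.θ_mem, by
        rw [tateD_tateMap, ← z.d_θ, map_sub, tateMap_twist_directSum, hz4, twist_zero_right,
          zero_add]
        rfl⟩
    refine ⟨(TwistedQ.mk x, TwistedQ.mk x'), ?_⟩
    rw [inclHom_mk, ← hz, ← TwistedQ.mk_add]
    set w := x.push biprod.inl (Bundle.pullback_inl γ γ') +
      x'.push biprod.inr (Bundle.pullback_inr γ γ') with hw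
    have hwφ : w.φ = z.φ := by
      rw [hw, push_add_push_φ, hzφ]
      change tateMap biprod.inl (tateMap biprod.fst z.φ) +
        tateMap biprod.inr (tateMap biprod.snd z.φ) = _
      rw [hz1, hz2]
    have hwθ : w.θ = tateMap biprod.inl (tateMap biprod.fst z.θ) +
        tateMap biprod.inr (tateMap biprod.snd z.θ) := push_add_push_θ x x'
    -- The `φ`-parts agree, so the `θ`-parts differ by a hyperquadratic cycle. Its diagonal blocks
    -- are zero, hence it bounds.
    refine TwistedQ.mk_eq_of_φ_eq hwφ (mem_tateBoundaries_of_tateMap_mem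
      ⟨AddSubgroup.sub_mem _ z.θ_mem w.θ_mem, ?_⟩ ?_ ?_)
    · change tateD _ _ (z.θ - w.θ) = 0
      rw [map_sub, ← z.d_θ, ← w.d_θ, hwφ, sub_self]
    · rw [map_sub, hwθ, tateMap_fst_add, sub_self]
      exact zero_mem _
    · rw [map_sub, hwθ, tateMap_snd_add, sub_self]
      exact zero_mem _
  · rintro ⟨⟨q, q'⟩, rfl⟩
    obtain ⟨x, rfl⟩ := TwistedQ.mk_surjective q
    obtain ⟨x', rfl⟩ := TwistedQ.mk_surjective q'
    rw [inclHom_mk, ← TwistedQ.mk_add, crossHom_mk]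
    refine TensorHomology.mk_eq_zero.2 ⟨0, zero_mem _, ?_⟩
    change _ = Tot.map biprod.fst biprod.snd (Tot.map biprod.inl biprod.inl (x.φ 0) +
      Tot.map biprod.inr biprod.inr (x'.φ 0))
    simp [Tot.map_map, Tot.map_zero_left, Tot.map_zero_right]

/-- A cycle `f` is the off-diagonal block of a structure on the sum exactly when diagonal blocks
`ξ`, `ξ'` exist for which `φ - φ_0^% (γ ⊕ γ')` bounds. Blockwise, and modulo the relations `2 = 0`
and `T = 1`, this says that both components of `k_* f` vanish. -/
theorem exact_crossHom_connectingHom (γ : Bundle C) (γ' : Bundle C') (n : ℤ) :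
    Function.Exact (crossHom γ γ' (n + 1)) (connectingHom γ γ' n) := by
  intro q
  constructor
  · obtain ⟨f, rfl⟩ := TensorHomology.mk_surjective q
    intro h
    rw [connectingHom_mk, Prod.mk_eq_zero, ← TwistedQ.ofTateHom_apply, ← TwistedQ.ofTateHom_apply,
      TwistedQ.ofTateHom_eq_zero, TwistedQ.ofTateHom_eq_zero] at h
    obtain ⟨⟨ξ, hξ, h1⟩, ξ', hξ', h2⟩ := h
    have hFd : Tot.d _ _ (Tot.map (biprod.inl : C ⟶ C ⊞ C') (biprod.inr : C' ⟶ C ⊞ C') f.1) = 0 :=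
      by rw [Tot.d_map, show Tot.d _ _ f.1 = 0 from f.2.2, map_zero]
    have hF : Tot.map (biprod.inl : C ⟶ C ⊞ C') (biprod.inr : C' ⟶ C ⊞ C') f.1 ∈
        Tot.deg _ _ (n + 1) := Tot.map_mem _ _ f.2.1
    set F := Tot.map (biprod.inl : C ⟶ C ⊞ C') (biprod.inr : C' ⟶ C ⊞ C') f.1 with hFdef
    have hTF : Tot.T _ _ F = Tot.map biprod.inr biprod.inl (Tot.T _ _ f.1) := Tot.T_map _ _ _
    have hcyc : ∀ {B : ChainComplex (ModuleCat.{u} A) ℤ} (i : B ⟶ C ⊞ C') {φ : ℤ → Tot B B},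
        φ ∈ symmetricCycles B (n + 1) → tateMap i φ ∈ symmetricCycles _ (n + 1) := fun i φ hφ =>
      ⟨tateMap_mem_symmetricChains i hφ.1, (tateD_tateMap i _ φ).trans (by
        rw [show tateD _ _ φ = 0 from hφ.2, map_zero])⟩
    -- The symmetric structure with diagonal blocks `ξ`, `ξ'` and off-diagonal blocks `f`, `T f`
    -- concentrated at index `0`.
    set φ : ℤ → Tot (C ⊞ C') (C ⊞ C') := tateMap biprod.inl ξ + tateMap biprod.inr ξ' +
      Pi.single 0 (F + Tot.T _ _ F) with hφdef
    have hφ : φ ∈ symmetricCycles _ (n + 1) := by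
      refine add_mem (add_mem (hcyc _ hξ) (hcyc _ hξ'))
        ⟨single_mem_symmetricChains (add_mem hF (Tot.T_mem_deg hF)), ?_⟩
      change tateD _ _ _ = 0
      rw [tateD_single _ _ (by rw [map_add, Tot.T_T, add_comm]), map_add, Tot.d_T, hFd]
      simp
    have hφ0 : φ 0 = Tot.map biprod.inl biprod.inl (ξ 0) + Tot.map biprod.inr biprod.inr (ξ' 0) +
        (F + Tot.map biprod.inr biprod.inl (Tot.T _ _ f.1)) := by
      rw [hφdef, ← hTF]
      simp
    have b11 : Tot.map biprod.fst biprod.fst (φ 0) = ξ 0 := by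
      rw [hφ0, hFdef]
      simp [Tot.map_map, Tot.map_id, Tot.map_zero_left, Tot.map_zero_right]
    have b12 : Tot.map biprod.fst biprod.snd (φ 0) = f.1 := by
      rw [hφ0, hFdef]
      simp [Tot.map_map, Tot.map_id, Tot.map_zero_left, Tot.map_zero_right]
    have b21 : Tot.map biprod.snd biprod.fst (φ 0) = Tot.T _ _ f.1 := by
      rw [hφ0, hFdef]
      simp [Tot.map_map, Tot.map_id, Tot.map_zero_left, Tot.map_zero_right]
    have b22 : Tot.map biprod.snd biprod.snd (φ 0) = ξ' 0 := by
      rw [hφ0, hFdef]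
      simp [Tot.map_map, Tot.map_id, Tot.map_zero_left, Tot.map_zero_right]
    have e1 : tateMap biprod.fst φ = ξ := by
      rw [hφdef, map_add, tateMap_fst_add]
      funext s
      rcases eq_or_ne s 0 with rfl | hs
      · simp [Tot.T_map, hFdef, Tot.map_map, Tot.map_zero_left, Tot.map_zero_right]
      · simp [hs]
    have e2 : tateMap biprod.snd φ = ξ' := by
      rw [hφdef, map_add, tateMap_snd_add]
      funext s
      rcases eq_or_ne s 0 with rfl | hs
      · simp [Tot.T_map, hFdef, Tot.map_map, Tot.map_zero_left, Tot.map_zero_right]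
      · simp [hs]
    have hdφ : Tot.d _ _ (φ 0) = 0 := by
      have h := congrFun (show tateD _ (n + 1) φ = 0 from hφ.2) 0
      rw [tateD_apply, hφ.1.2 (0 - 1) (by norm_num)] at h
      simpa using h
    have hd : ∀ {B B' : ChainComplex (ModuleCat.{u} A) ℤ} (p : C ⊞ C' ⟶ B) (q : C ⊞ C' ⟶ B'),
        Tot.d _ _ (Tot.map p q (φ 0)) = 0 := fun p q => by rw [Tot.d_map, hdφ, map_zero]
    have hb : φ - twist (n + 1) (γ.directSum γ') (φ 0) ∈ tateBoundaries _ (n + 1) := by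
      refine mem_tateBoundaries_of_tateMap_mem
        (sub_mem ⟨hφ.1.1, hφ.2⟩ (twist_mem_tateCycles _ hdφ)) ?_ ?_
      · rw [map_sub, tateMap_twist_directSum, b11, b21, e1]
        have k1 := twist_add_homotopyTwist_mem_tateBoundaries γ (n := n) (b11 ▸ hd _ _)
        have k2 := add_self_mem_tateBoundaries
          (twist_mem_tateCycles (n := n + 1) γ' (b21 ▸ hd _ _))
        have k3 := add_self_mem_tateBoundaries
          (twist_mem_tateCycles (n := n + 1) γ (b11 ▸ hd _ _))
        -- The vanishing condition `h1` has the homotopy term of `ξ_0` and the twist of `T f` with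
        -- the wrong sign. Here `k1` trades the homotopy term for the twist of `ξ_0`, and the
        -- doubles `k2`, `k3` reverse the signs.
        convert sub_mem (sub_mem (add_mem h1 k1) k2) k3 using 1
        simp only [twistCycle, transposeCycle]
        abel
      · rw [map_sub, tateMap_twist_directSum, b12, b22, e2]
        have k1 := twist_add_homotopyTwist_mem_tateBoundaries γ' (n := n) (b22 ▸ hd _ _)
        have k2 := add_self_mem_tateBoundaries
          (twist_mem_tateCycles (n := n + 1) γ' (b22 ▸ hd _ _))
        convert sub_mem (add_mem h2 k1) k2 using 1
        simp only [twistCycle, NegMemClass.coe_neg]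
        abel
    obtain ⟨θ, hθ, hθd⟩ := hb
    exact ⟨TwistedQ.mk ⟨φ, θ, hφ, hθ, hθd.symm⟩,
      congrArg TensorHomology.mk (Subtype.ext b12)⟩
  · rintro ⟨p, rfl⟩
    obtain ⟨y, rfl⟩ := TwistedQ.mk_surjective p
    have hd : ∀ {B B' : ChainComplex (ModuleCat.{u} A) ℤ} (p : C ⊞ C' ⟶ B) (q : C ⊞ C' ⟶ B'),
        Tot.d _ _ (Tot.map p q (y.φ 0)) = 0 := fun p q => by rw [Tot.d_map, y.d_φ_zero, map_zero]
    have hcyc : ∀ {E : ChainComplex (ModuleCat.{u} A) ℤ} (f : C ⊞ C' ⟶ E),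
        tateMap f y.φ ∈ symmetricCycles E (n + 1) := fun f =>
      ⟨tateMap_mem_symmetricChains f y.φ_mem.1, (tateD_tateMap f _ y.φ).trans (by
        rw [show tateD _ _ y.φ = 0 from y.φ_mem.2, map_zero])⟩
    have hB := y.d_θ_mem
    have hB1 := tateMap_mem_tateBoundaries biprod.fst hB
    have hB2 := tateMap_mem_tateBoundaries biprod.snd hB
    rw [map_sub, tateMap_twist_directSum] at hB1 hB2
    rw [crossHom_mk, connectingHom_mk, Prod.mk_eq_zero, ← TwistedQ.ofTateHom_apply,
      ← TwistedQ.ofTateHom_apply, TwistedQ.ofTateHom_eq_zero, TwistedQ.ofTateHom_eq_zero]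
    -- The diagonal blocks of `y.φ` are the symmetric cycles that annihilate the two components of
    -- `k_*`.
    refine ⟨⟨_, hcyc biprod.fst, ?_⟩, _, hcyc biprod.snd, ?_⟩
    · have k1 := twist_add_homotopyTwist_mem_tateBoundaries γ (n := n) (hd biprod.fst biprod.fst)
      have k2 := add_self_mem_tateBoundaries
        (twist_mem_tateCycles (n := n + 1) γ' (hd biprod.snd biprod.fst))
      have k3 := add_self_mem_tateBoundaries
        (twist_mem_tateCycles (n := n + 1) γ (hd biprod.fst biprod.fst))
      have k4 := twist_T_sub_twist_mem_tateBoundaries (m := n + 1) (γ' := γ') (ξ := y.φ)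
        (by rw [y.d_φ_zero, map_zero]) (by rw [y.d_φ_zero, map_zero])
        (by rw [show tateD _ _ y.φ = 0 from y.φ_mem.2, Pi.zero_apply, map_zero])
      change twist (n + 1) γ' (Tot.T C C' (Tot.map biprod.fst biprod.snd (y.φ 0))) +
        tateMap biprod.fst y.φ -
        homotopyTwist n γ 0 0 (Tot.map biprod.fst biprod.fst (y.φ 0)) ∈ _
      convert add_mem (sub_mem (add_mem (add_mem hB1 k4) k2) k1) k3 using 1
      abel
    · have k1 := twist_add_homotopyTwist_mem_tateBoundaries γ' (n := n)
        (hd biprod.snd biprod.snd)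
      have k2 := add_self_mem_tateBoundaries
        (twist_mem_tateCycles (n := n + 1) γ' (hd biprod.snd biprod.snd))
      change -twist (n + 1) γ (Tot.map biprod.fst biprod.snd (y.φ 0)) +
        tateMap biprod.snd y.φ -
        homotopyTwist n γ' 0 0 (Tot.map biprod.snd biprod.snd (y.φ 0)) ∈ _
      convert add_mem (sub_mem hB2 k1) k2 using 1
      abel

/-- A null-homotopy `ξ` of the sum of two structures has a cycle `f` as the off-diagonal block of
`ξ_0`, since `d ξ_0` is block-diagonal. The diagonal blocks of `ξ` show that the given pair of
classes is `k_* f`. Conversely, `F + T F` at index `0` is a null-homotopy of `i_* k_* f`. -/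
theorem exact_connectingHom_inclHom (γ : Bundle C) (γ' : Bundle C') (n : ℤ) :
    Function.Exact (connectingHom γ γ' n) (inclHom γ γ' n) := by
  rintro ⟨q, q'⟩
  constructor
  · obtain ⟨x, rfl⟩ := TwistedQ.mk_surjective q
    obtain ⟨x', rfl⟩ := TwistedQ.mk_surjective q'
    intro h
    rw [inclHom_mk, ← TwistedQ.mk_add, ← map_zero (TwistedQ.ofTateHom _ _), eq_comm,
      TwistedQ.ofTateHom_eq_mk] at h
    obtain ⟨ξ, hξ, h1, h2⟩ := h
    rw [push_add_push_φ] at h1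
    rw [push_add_push_θ, push_add_push_φ, ZeroMemClass.coe_zero, sub_zero] at h2
    have h0 : Tot.d _ _ (ξ 0) = Tot.map biprod.inl biprod.inl (x.φ 0) +
        Tot.map biprod.inr biprod.inr (x'.φ 0) := SymmetricStructure.d_zero_eq hξ h1
    have c12 : Tot.map biprod.fst biprod.snd (Tot.d _ _ (ξ 0)) = 0 := by
      rw [h0]
      simp [Tot.map_map, Tot.map_zero_left, Tot.map_zero_right]
    have c21 : Tot.map biprod.snd biprod.fst (Tot.d _ _ (ξ 0)) = 0 := by
      rw [h0]
      simp [Tot.map_map, Tot.map_zero_left, Tot.map_zero_right]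
    have hξ0 : ξ 0 ∈ Tot.deg _ _ (n + 1) := by simpa using hξ.1 0
    let f : Tot.cycles C C' (n + 1) := ⟨Tot.map biprod.fst biprod.snd (ξ 0),
      Tot.map_mem _ _ hξ0, by
        change Tot.d _ _ _ = 0
        rw [Tot.d_map, c12]⟩
    have k4 := twist_T_sub_twist_mem_tateBoundaries (m := n + 1) (γ' := γ') c12 c21 (by
      rw [← h1]
      simp [Tot.map_map, Tot.map_zero_left, Tot.map_zero_right])
    have k1 := twist_add_homotopyTwist_mem_tateBoundaries γ' (n := n)
      (g := Tot.map biprod.snd biprod.fst (ξ 0)) (by rw [Tot.d_map, c21])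
    have k2 := twist_add_homotopyTwist_mem_tateBoundaries γ (n := n)
      (g := Tot.map biprod.fst biprod.snd (ξ 0)) (by rw [Tot.d_map, c12])
    have k3 := add_self_mem_tateBoundaries (twist_mem_tateCycles (n := n + 1) γ
      (f := Tot.map biprod.fst biprod.snd (ξ 0)) (by rw [Tot.d_map, c12]))
    have a1 := tateMap_mem_tateBoundaries biprod.fst h2
    have a2 := tateMap_mem_tateBoundaries biprod.snd h2
    rw [map_add, map_sub, tateMap_fst_add, tateMap_homotopyTwist_directSum] at a1
    rw [map_add, map_sub, tateMap_snd_add, tateMap_homotopyTwist_directSum] at a2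
    simp only [Pi.add_apply, tateMap_apply, map_add, Tot.map_map, biprod.inl_fst, biprod.inl_snd,
      biprod.inr_fst, biprod.inr_snd, Tot.map_id, Tot.map_zero_left, Tot.map_zero_right, add_zero,
      zero_add, map_zero] at a1 a2
    refine ⟨TensorHomology.mk f, ?_⟩
    rw [connectingHom_mk, ← TwistedQ.ofTateHom_apply, ← TwistedQ.ofTateHom_apply]
    -- Projecting the relation for `ξ` leaves the homotopy term of an off-diagonal block, to be
    -- exchanged for its twist: `k1`, `k4` do this for `T f` in the first component, `k2`, `k3` for
    -- `f` in the second.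
    refine Prod.ext (TwistedQ.ofTateHom_eq_mk.2 ⟨tateMap biprod.fst ξ,
      tateMap_mem_symmetricChains _ hξ, ?_, ?_⟩) (TwistedQ.ofTateHom_eq_mk.2
      ⟨tateMap biprod.snd ξ, tateMap_mem_symmetricChains _ hξ, ?_, ?_⟩)
    · rw [tateD_tateMap, ← h1, tateMap_fst_add]
    · change x.θ - twist (n + 1) γ' (Tot.T C C' (Tot.map biprod.fst biprod.snd (ξ 0))) -
        tateMap biprod.fst ξ +
        homotopyTwist n γ 0 (x.φ 0) (Tot.map biprod.fst biprod.fst (ξ 0)) ∈ _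
      convert sub_mem (sub_mem a1 k4) k1 using 1
      abel
    · rw [tateD_tateMap, ← h1, tateMap_snd_add]
    · change x'.θ - -twist (n + 1) γ (Tot.map biprod.fst biprod.snd (ξ 0)) -
        tateMap biprod.snd ξ +
        homotopyTwist n γ' 0 (x'.φ 0) (Tot.map biprod.snd biprod.snd (ξ 0)) ∈ _
      convert add_mem (sub_mem a2 k2) k3 using 1
      abel
  · rintro ⟨p, hp⟩
    obtain ⟨f, rfl⟩ := TensorHomology.mk_surjective p
    rw [← hp, connectingHom_mk, inclHom_mk, ← TwistedQ.mk_add, eq_comm,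
      ← map_zero (TwistedQ.ofTateHom _ _), TwistedQ.ofTateHom_eq_mk]
    have hFd : Tot.d _ _ (Tot.map (biprod.inl : C ⟶ C ⊞ C') (biprod.inr : C' ⟶ C ⊞ C') f.1) = 0 :=
      by rw [Tot.d_map, show Tot.d _ _ f.1 = 0 from f.2.2, map_zero]
    have hF : Tot.map (biprod.inl : C ⟶ C ⊞ C') (biprod.inr : C' ⟶ C ⊞ C') f.1 ∈
        Tot.deg _ _ (n + 1) := Tot.map_mem _ _ f.2.1
    set F := Tot.map (biprod.inl : C ⟶ C ⊞ C') (biprod.inr : C' ⟶ C ⊞ C') f.1 with hFdef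
    have hGd : Tot.d _ _ (F + Tot.T _ _ F) = 0 := by
      rw [map_add, Tot.d_T, hFd, map_zero, add_zero]
    have hGm := single_mem_symmetricChains (add_mem hF (Tot.T_mem_deg hF))
    have hGc : tateD _ (n + 1) (Pi.single 0 (F + Tot.T _ _ F)) = 0 := by
      rw [tateD_single _ _ (by rw [map_add, Tot.T_T, add_comm]), hGd, Pi.single_zero]
    rw [push_add_push_φ, push_add_push_θ]
    refine ⟨_, hGm, ?_, ?_⟩
    · rw [hGc]
      change tateMap biprod.inl 0 + tateMap biprod.inr 0 = _
      simp
    · change tateMap biprod.inl (twist (n + 1) γ' (Tot.T C C' f.1)) +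
        tateMap biprod.inr (-twist (n + 1) γ f.1) - 0 - Pi.single 0 (F + Tot.T _ _ F) +
        homotopyTwist n (γ.directSum γ') 0 (Tot.map biprod.inl biprod.inl 0 +
          Tot.map biprod.inr biprod.inr 0) ((Pi.single 0 (F + Tot.T _ _ F) : ℤ → _) 0) ∈ _
      rw [map_zero, map_zero, add_zero, Pi.single_eq_same]
      have hfd : Tot.d C C' f.1 = 0 := f.2.2
      have hTd : Tot.d C' C (Tot.T C C' f.1) = 0 := by rw [Tot.d_T, hfd, map_zero]
      have k0 := twist_add_homotopyTwist_mem_tateBoundaries (γ.directSum γ') (n := n) hGd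
      -- The cycle `k0` allows the homotopy term of `F + T F` to be replaced by minus its twist. The
      -- remaining cycle is tested on diagonal blocks: the first is zero, the second is `-2 f^% γ`,
      -- which bounds.
      have hz : tateMap biprod.inl (twist (n + 1) γ' (Tot.T C C' f.1)) +
          tateMap biprod.inr (-twist (n + 1) γ f.1) - Pi.single 0 (F + Tot.T _ _ F) -
          twist (n + 1) (γ.directSum γ') (F + Tot.T _ _ F) ∈ tateBoundaries _ (n + 1) := by
        have hp : ∀ {E : ChainComplex (ModuleCat.{u} A) ℤ} (i : E ⟶ C ⊞ C') (θ : ℤ → Tot E E),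
            θ ∈ tateCycles E (n + 1) → tateMap i θ ∈ tateCycles _ (n + 1) := fun i θ h =>
          ⟨tateMap_mem_tateChains i h.1, (tateD_tateMap i _ θ).trans (by
            rw [show tateD _ _ θ = 0 from h.2, map_zero])⟩
        refine mem_tateBoundaries_of_tateMap_mem (sub_mem (sub_mem (add_mem
          (hp _ _ (twist_mem_tateCycles _ hTd)) (hp _ _ (neg_mem (twist_mem_tateCycles _ hfd))))
          ⟨hGm.1, hGc⟩) (twist_mem_tateCycles _ hGd)) ?_ ?_
        · have e : tateMap biprod.fst (Pi.single 0 (F + Tot.T _ _ F)) = 0 := by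
            funext s
            rcases eq_or_ne s 0 with rfl | hs
            · simp [Tot.T_map, hFdef, Tot.map_map, Tot.map_zero_left, Tot.map_zero_right]
            · simp [hs]
          rw [map_sub, map_sub, tateMap_fst_add, e, tateMap_twist_directSum, map_add, map_add,
            hFdef, Tot.T_map]
          simp [Tot.map_map, Tot.map_id, Tot.map_zero_left, Tot.map_zero_right, zero_mem]
        · have e : tateMap biprod.snd (Pi.single 0 (F + Tot.T _ _ F)) = 0 := by
            funext s
            rcases eq_or_ne s 0 with rfl | hs
            · simp [Tot.T_map, hFdef, Tot.map_map, Tot.map_zero_left, Tot.map_zero_right]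
            · simp [hs]
          rw [map_sub, map_sub, tateMap_snd_add, e, tateMap_twist_directSum, map_add, map_add,
            hFdef, Tot.T_map]
          simp only [Tot.map_map, Tot.map_id, Tot.map_zero_left, Tot.map_zero_right,
            biprod.inl_fst, biprod.inl_snd, biprod.inr_fst, biprod.inr_snd, add_zero,
            twist_zero_right, sub_zero]
          convert neg_mem (add_self_mem_tateBoundaries (twist_mem_tateCycles (n := n + 1) γ hfd))
            using 1
          abel
      convert add_mem hz k0 using 1
      abel

end

section

variable {A : Type u} [Ring A] [StarRing A]
variable {C D C' : ChainComplex (ModuleCat.{u} A) ℤ}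

/-! ### Chain homotopies -/

namespace Tot

/-- The operator `x ⊗ y ↦ (-1)^q h x ⊗ y` (`y ∈ D_q`) given by morphisms `h : C_p → C_{p+1}`. -/
def homotopyLeft (h : ∀ p q : ℤ, C.X p ⟶ C.X q) (D : ChainComplex (ModuleCat.{u} A) ℤ) :
    Tot C D →+ Tot C D :=
  lift fun p q => sg q • (incl C D (p + 1) q).comp (Tens.map (h p (p + 1)).hom LinearMap.id)

theorem homotopyLeft_tmul (h : ∀ p q : ℤ, C.X p ⟶ C.X q) (p q : ℤ) (x : C.X p) (y : D.X q) :
    homotopyLeft h D (tmul C D p q x y) =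
      sg q • tmul C D (p + 1) q ((h p (p + 1)).hom x) y := by
  rw [homotopyLeft, lift_tmul]; simp [tmul]

theorem tmul_hom_congr (h : ∀ p q : ℤ, C.X p ⟶ C.X q) {p q q' r : ℤ} (e : q = q') (x : C.X p)
    (y : D.X r) : tmul C D q r ((h p q).hom x) y = tmul C D q' r ((h p q').hom x) y := by
  subst e; rfl

theorem homotopyLeft_mem_deg (h : ∀ p q : ℤ, C.X p ⟶ C.X q) {n n' : ℤ} (hn : n' = n + 1)
    {z : Tot C D} (hz : z ∈ deg C D n) : homotopyLeft h D z ∈ deg C D n' := by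
  refine map_mem_deg _ (fun p q x y hpq => ?_) hz
  rw [homotopyLeft_tmul]
  exact zsmul_mem (tmul_mem_deg (by omega) _ _) _

theorem d_homotopyLeft {p : C ⟶ C} (h : Homotopy p (𝟙 C)) (z : Tot C D) :
    d C D (homotopyLeft h.hom D z) + homotopyLeft h.hom D (d C D z) = map p (𝟙 D) z - z := by
  refine DFunLike.congr_fun (f := (d C D).comp (homotopyLeft h.hom D) +
    (homotopyLeft h.hom D).comp (d C D)) (g := map p (𝟙 D) - AddMonoidHom.id _)
    (ext fun i j x y => ?_) z
  have hc := h.comm i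
  rw [dNext_eq h.hom (show (ComplexShape.down ℤ).Rel i (i - 1) by simp),
    prevD_eq h.hom (show (ComplexShape.down ℤ).Rel (i + 1) i by simp)] at hc
  have hx := ConcreteCategory.congr_hom hc x
  simp only [ModuleCat.hom_add, ModuleCat.hom_comp, LinearMap.add_apply, LinearMap.comp_apply,
    HomologicalComplex.id_f] at hx
  simp only [AddMonoidHom.add_apply, AddMonoidHom.comp_apply, AddMonoidHom.sub_apply,
    AddMonoidHom.id_apply, homotopyLeft_tmul, d_tmul, map_tmul, map_zsmul, map_add, smul_add,
    smul_smul, sg_mul_self, one_smul]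
  rw [tmul_congr_left (show i + 1 - 1 = i by ring),
    tmul_hom_congr h.hom (show i - 1 + 1 = i by ring)]
  rw [hx, tmul_add_left, tmul_add_left, sg_sub, sg_one]
  simp only [ModuleCat.hom_id, LinearMap.id_apply, HomologicalComplex.id_f]
  module

/-- The operator `x ⊗ y ↦ x ⊗ h y`. -/
def homotopyRight (C : ChainComplex (ModuleCat.{u} A) ℤ) (h : ∀ p q : ℤ, D.X p ⟶ D.X q) :
    Tot C D →+ Tot C D :=
  (T D C).comp ((homotopyLeft h C).comp (T C D))

theorem homotopyRight_tmul (h : ∀ p q : ℤ, D.X p ⟶ D.X q) (p q : ℤ) (x : C.X p) (y : D.X q) :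
    homotopyRight C h (tmul C D p q x y) =
      tmul C D p (q + 1) x ((h q (q + 1)).hom y) := by
  simp only [homotopyRight, AddMonoidHom.comp_apply, T_tmul, map_zsmul, homotopyLeft_tmul,
    smul_smul, ← sg_add]
  rw [sg_congr (n := 0) ⟨p * q + p, by ring⟩, sg_zero, one_smul]

/-- Both operators have degree one and act on different factors, so they anticommute. -/
theorem homotopyRight_homotopyLeft (h : ∀ p q : ℤ, C.X p ⟶ C.X q)
    (h' : ∀ p q : ℤ, D.X p ⟶ D.X q) (z : Tot C D) :
    homotopyRight C h' (homotopyLeft h D z) = -homotopyLeft h D (homotopyRight C h' z) := by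
  refine DFunLike.congr_fun (f := (homotopyRight C h').comp (homotopyLeft h D))
    (g := -(homotopyLeft h D).comp (homotopyRight C h')) (ext fun i j x y => ?_) z
  simp only [AddMonoidHom.comp_apply, AddMonoidHom.neg_apply, homotopyRight_tmul, map_zsmul,
    homotopyLeft_tmul, sg_add, sg_one]
  module

theorem homotopyLeft_map (h : ∀ p q : ℤ, C.X p ⟶ C.X q) (f : D ⟶ D) (z : Tot C D) :
    homotopyLeft h D (map (𝟙 C) f z) = map (𝟙 C) f (homotopyLeft h D z) := by
  refine DFunLike.congr_fun (f := (homotopyLeft h D).comp (map (𝟙 C) f))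
    (g := (map (𝟙 C) f).comp (homotopyLeft h D)) (ext fun i j x y => ?_) z
  simp [homotopyLeft_tmul, map_tmul]

end Tot

namespace Tot

theorem d_homotopyLeft_eq {p : C ⟶ C} (h : Homotopy p (𝟙 C)) (z : Tot C D) :
    d C D (homotopyLeft h.hom D z) = map p (𝟙 D) z - z - homotopyLeft h.hom D (d C D z) :=
  eq_sub_of_add_eq (d_homotopyLeft h z)

theorem T_homotopyLeft (h : ∀ p q : ℤ, C.X p ⟶ C.X q) (z : Tot C D) :
    T C D (homotopyLeft h D z) = homotopyRight D h (T C D z) := by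
  simp [homotopyRight]

theorem T_homotopyRight (h : ∀ p q : ℤ, D.X p ⟶ D.X q) (z : Tot C D) :
    T C D (homotopyRight C h z) = homotopyLeft h C (T C D z) := by
  simp [homotopyRight]

theorem d_homotopyRight {p : D ⟶ D} (h : Homotopy p (𝟙 D)) (z : Tot C D) :
    d C D (homotopyRight C h.hom z) = map (𝟙 C) p z - z - homotopyRight C h.hom (d C D z) := by
  simp only [homotopyRight, AddMonoidHom.comp_apply, d_T, d_homotopyLeft_eq, map_sub, T_T, T_map]

theorem homotopyRight_map (h : ∀ p q : ℤ, D.X p ⟶ D.X q) (f : C ⟶ C) (z : Tot C D) :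
    map f (𝟙 D) (homotopyRight C h z) = homotopyRight C h (map f (𝟙 D) z) := by
  simp only [homotopyRight, AddMonoidHom.comp_apply]
  rw [T_map, homotopyLeft_map, T_map]

end Tot

/-- The chain homotopy of `p^%` and the identity on `Ŵ^% C`, in degree `m`. -/
def tateHomotopy (h : ∀ p q : ℤ, C.X p ⟶ C.X q) (p : C ⟶ C) (m : ℤ) (θ : ℤ → Tot C C) :
    ℤ → Tot C C := fun s =>
  -- Writing `L`, `R` for the two one-sided operators, `(1 ⊗ p) L + R` is a homotopy from `p ⊗ p` to
  -- the identity that is not `T`-equivariant. Its conjugate by `T` differs from it by the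
  -- commutator of `d` with `L R`, which the last term corrects.
  Tot.map (𝟙 C) p (Tot.homotopyLeft h C (θ s)) + Tot.homotopyRight C h (θ s) -
    sg m • Tot.homotopyLeft h C (Tot.homotopyRight C h (Tot.T C C (θ (s - 1))))

theorem tateHomotopy_mem_tateChains (h : ∀ p q : ℤ, C.X p ⟶ C.X q) (p : C ⟶ C) {m : ℤ}
    {θ : ℤ → Tot C C} (hθ : θ ∈ tateChains C m) :
    tateHomotopy h p m θ ∈ tateChains C (m + 1) := by
  have hR : ∀ {n n' : ℤ} {z : Tot C C}, n' = n + 1 → z ∈ Tot.deg C C n →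
      Tot.homotopyRight C h z ∈ Tot.deg C C n' := fun hn hz =>
    Tot.T_mem_deg (Tot.homotopyLeft_mem_deg h hn (Tot.T_mem_deg hz))
  intro s
  exact sub_mem (add_mem (Tot.map_mem _ _ (Tot.homotopyLeft_mem_deg h (by ring) (hθ s)))
    (hR (by ring) (hθ s))) (zsmul_mem (Tot.homotopyLeft_mem_deg h (n := m + s) (by ring)
    (hR (by ring) (Tot.T_mem_deg (hθ (s - 1))))) _)

/-- The entry of index `s` uses only the entries `s` and `s - 1`, so vanishing in negative indices
is preserved. -/
theorem tateHomotopy_mem_symmetricChains (h : ∀ p q : ℤ, C.X p ⟶ C.X q) (p : C ⟶ C) {m : ℤ}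
    {φ : ℤ → Tot C C} (hφ : φ ∈ symmetricChains C m) :
    tateHomotopy h p m φ ∈ symmetricChains C (m + 1) :=
  ⟨tateHomotopy_mem_tateChains h p hφ.1, fun s hs => by
    simp [tateHomotopy, hφ.2 s hs, hφ.2 (s - 1) (by omega)]⟩

/-- Stated for arbitrary families, not only cycles, because it is applied to `θ` with `d θ = φ`. -/
theorem tateD_tateHomotopy {p : C ⟶ C} (h : Homotopy p (𝟙 C)) (m : ℤ) (θ : ℤ → Tot C C) :
    tateD C (m + 1) (tateHomotopy h.hom p m θ) + tateHomotopy h.hom p (m - 1) (tateD C m θ) =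
      tateMap p θ - θ := by
  funext s
  simp only [Pi.add_apply, Pi.sub_apply, tateD_apply, tateHomotopy, tateMap_apply, map_add, map_sub,
    map_zsmul, Tot.d_map, Tot.d_T, Tot.d_homotopyLeft_eq, Tot.d_homotopyRight, Tot.T_map, Tot.T_T,
    Tot.T_homotopyLeft, Tot.T_homotopyRight, Tot.homotopyRight_homotopyLeft,
    ← Tot.homotopyLeft_map, Tot.homotopyRight_map, Tot.map_map, Category.comp_id,
    Category.id_comp]
  simp only [sg_sub, sg_add, sg_one]
  rcases sg_eq m with h | h <;> rcases sg_eq s with h' | h' <;> rw [h, h'] <;> module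

end

section

section Bounded

variable {A : Type u} [Ring A] {C C' : ChainComplex (ModuleCat.{u} A) ℤ}

/-! ### Chain complexes which are bounded below up to homotopy -/

/-- The identity of `C` is homotopic to a chain map which is zero in negative degrees. -/
def IsHomotopyBounded (C : ChainComplex (ModuleCat.{u} A) ℤ) : Prop :=
  ∃ p : C ⟶ C, Nonempty (Homotopy p (𝟙 C)) ∧ ∀ r < 0, p.f r = 0

/-- The self-map factors through a complex which is zero in negative degrees. -/
theorem IsFiniteDimensional.isHomotopyBounded (h : IsFiniteDimensional C) :
    IsHomotopyBounded C := by
  obtain ⟨m, D, hD, ⟨e⟩⟩ := h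
  refine ⟨e.hom ≫ e.inv, ⟨e.homotopyHomInvId⟩, fun r hr => ?_⟩
  have := hD.2 r (Or.inl hr)
  ext x
  have hx : (e.hom.f r).hom x = 0 := Subsingleton.elim _ _
  simp [hx]

theorem IsHomotopyBounded.biprod (h : IsHomotopyBounded C) (h' : IsHomotopyBounded C') :
    IsHomotopyBounded (C ⊞ C') := by
  obtain ⟨p, ⟨e⟩, hp⟩ := h
  obtain ⟨p', ⟨e'⟩, hp'⟩ := h'
  refine ⟨biprod.fst ≫ p ≫ biprod.inl + biprod.snd ≫ p' ≫ biprod.inr, ⟨?_⟩, fun r hr => ?_⟩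
  · refine (((e.compRight biprod.inl).compLeft biprod.fst).add
      ((e'.compRight biprod.inr).compLeft biprod.snd)).trans (Homotopy.ofEq ?_)
    simp
  · simp [hp r hr, hp' r hr]

end Bounded

variable {A : Type u} [Ring A] [StarRing A]
variable {C D : ChainComplex (ModuleCat.{u} A) ℤ}

/-- In negative total degree one of the two tensor factors has negative degree. -/
theorem Tot.map_eq_zero {p : C ⟶ C} (hp : ∀ r < 0, p.f r = 0) {n : ℤ} (hn : n < 0) {z : Tot C C}
    (hz : z ∈ Tot.deg C C n) : Tot.map p p z = 0 := by
  have h : Tot.deg C C n ≤ (Tot.map p p).ker := by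
    rw [Tot.deg, AddSubgroup.closure_le]
    rintro _ ⟨i, j, x, y, hij, rfl⟩
    change Tot.map p p _ = 0
    rw [Tot.map_tmul]
    rcases lt_or_ge i 0 with hi | hi
    · rw [hp i hi]
      have h := Tot.tmul_zsmul_left (C := C) (D := C) 0 i j 0 ((p.f j).hom y)
      simpa using h
    · rw [hp j (by omega)]
      have h := Tot.tmul_zsmul_right (C := C) (D := C) 0 i j ((p.f i).hom x) 0
      simpa using h
  exact h hz

/-! ### Quadratic structures and the untwisted case -/

/-- Under `s = -t - 1` the negative-index part of the hyperquadratic complex carries the quadratic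
differential, with the degree lowered by one. The constant `c` accommodates the sign `(-1)^n` of the
comparison map. -/
theorem quadraticD_tate (m c : ℤ) (η : ℤ → Tot C C) (t : ℕ) :
    quadraticD C m (fun t : ℕ => c • η (-t - 1)) t = c • tateD C (m + 1) η (-t - 1) := by
  rw [tateD_apply]
  change Tot.d C C (c • η (-t - 1)) + sg (m - t - 1) • (c • η (-(t + 1 : ℕ) - 1) +
    sg (t + 1) • Tot.T C C (c • η (-(t + 1 : ℕ) - 1))) = _
  rw [show -((t + 1 : ℕ) : ℤ) - 1 = -t - 1 - 1 by push_cast; ring,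
    sg_congr (m := m + 1 + (-t - 1) - 1) (n := m - t - 1) ⟨0, by ring⟩,
    sg_congr (m := -t - 1) (n := t + 1) ⟨-t - 1, by ring⟩, map_zsmul, map_zsmul]
  module

theorem mem_quadraticChains_tate {m c N : ℤ} {η : ℤ → Tot C C} (hη : η ∈ tateChains C (m + 1))
    (h : ∀ s < N, η s = 0) : (fun t : ℕ => c • η (-t - 1)) ∈ quadraticChains C m := by
  refine ⟨fun t => ?_, (Set.finite_Iio (-N + 1).toNat).subset fun t ht => ?_⟩
  · rw [show m - (t : ℤ) = m + 1 + (-t - 1) by ring]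
    exact zsmul_mem (hη _) _
  · by_contra hN
    refine ht ?_
    rw [Set.mem_Iio] at hN
    change c • η (-t - 1) = 0
    rw [h _ (by omega), smul_zero]

namespace SymmetricStructure

variable {γ : Bundle C} {n : ℤ} (hγ : γ = 0)

theorem ofQuadratic_φ (ψ : quadraticCycles C n) :
    (ofQuadratic hγ ψ).φ = Pi.single 0 (ψ.1 0 + Tot.T C C (ψ.1 0)) := by
  funext s
  rcases eq_or_ne s 0 with rfl | hs
  · simp [ofQuadratic]
  · simp [ofQuadratic, hs]

theorem ofQuadratic_θ_of_neg (ψ : quadraticCycles C n) {s : ℤ} (hs : s < 0) :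
    (ofQuadratic hγ ψ).θ s = sg n • ψ.1 (-s - 1).toNat := if_pos (by omega)

theorem ofQuadratic_θ_of_nonneg (ψ : quadraticCycles C n) {s : ℤ} (hs : 0 ≤ s) :
    (ofQuadratic hγ ψ).θ s = 0 := if_neg (by omega)

theorem homotopyTwist_bundle_zero (f f' g : Tot C D) :
    homotopyTwist n (0 : Bundle C) f f' g = 0 := by
  funext s
  have h : ∀ t, (0 : Bundle C).1 t = 0 := fun _ => rfl
  simp [homotopyTwist, h]

theorem sumTwist_bundle_zero (f f' : Tot C D) : sumTwist n (0 : Bundle C) f f' = 0 := by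
  funext s
  have h : ∀ t, (0 : Bundle C).1 t = 0 := fun _ => rfl
  simp [sumTwist, h]

theorem φ_eq_of_bundle_zero (x : SymmetricStructure γ n) (hγ : γ = 0) :
    x.φ = tateD C (n + 1) x.θ := by
  rw [← x.d_θ, show twist n γ (x.φ 0) = 0 from hγ ▸ twist_zero_left n (x.φ 0), sub_zero]

end SymmetricStructure

namespace TwistedQ

open SymmetricStructure

variable {γ : Bundle C} {n : ℤ}

/-- Equality in the twisted quadratic group of the trivial bundle. -/
theorem mk_eq_mk_of_bundle_zero (hγ : γ = 0) {x y : SymmetricStructure γ n} : mk x = mk y ↔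
    ∃ ξ ∈ symmetricChains C (n + 1), y.φ - x.φ = tateD C (n + 1) ξ ∧
      ∃ η ∈ tateChains C (n + 2), y.θ - x.θ - ξ = tateD C (n + 2) η := by
  subst hγ
  rw [mk_eq_mk]
  simp only [homotopyTwist_bundle_zero, add_zero,
    mem_tateBoundaries (show n + 2 = n + 1 + 1 by ring)]

/-- The homomorphism `ψ ↦ ((1 + T) ψ_0, θ)` from `Q_n(C)` to `Q_n(C, 0)`. -/
def ofQuadraticHom (hγ : γ = 0) : QuadraticQ C n →+ TwistedQ γ n :=
  QuotientAddGroup.lift _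
    (AddMonoidHom.mk' (fun ψ : quadraticCycles C n => mk (ofQuadratic hγ ψ)) fun ψ ψ' => by
      refine congrArg mk (SymmetricStructure.ext ?_ ?_)
      · rw [add_φ, ofQuadratic_φ, ofQuadratic_φ, ofQuadratic_φ, ← Pi.single_add]
        congr 1
        change ψ.1 0 + ψ'.1 0 + Tot.T C C (ψ.1 0 + ψ'.1 0) = _
        rw [map_add]
        abel
      · rw [add_θ, show ∀ f f' : Tot C C, sumTwist n γ f f' = 0 from
          hγ ▸ sumTwist_bundle_zero, add_zero]
        funext s
        rw [Pi.add_apply]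
        rcases lt_or_ge s 0 with hs | hs
        · rw [ofQuadratic_θ_of_neg _ _ hs, ofQuadratic_θ_of_neg _ _ hs,
            ofQuadratic_θ_of_neg _ _ hs, ← smul_add]
          rfl
        · simp only [ofQuadratic_θ_of_nonneg _ _ hs, add_zero])
    (by
      rintro ⟨ψ, hψ⟩ ⟨χ, hχ, h⟩
      change mk (ofQuadratic hγ ⟨ψ, hψ⟩) = mk 0
      replace h : quadraticD C (n + 1) χ = ψ := h
      have hχ0 : χ 0 ∈ Tot.deg C C (n + 1) := by simpa using hχ.1 0
      have hψ0 : ψ 0 = Tot.d C C (χ 0) + sg n • (χ 1 - Tot.T C C (χ 1)) := by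
        rw [← h]
        change Tot.d C C (χ 0) + sg (n + 1 - (0 : ℕ) - 1) • (χ 1 + sg ((0 : ℕ) + 1) •
          Tot.T C C (χ 1)) = _
        rw [Nat.cast_zero, zero_add, sub_zero, add_sub_cancel_right, sg_one]
        module
      -- For `ψ = d χ`: `(1 + T) χ_0` at index `0` bounds the symmetric part, and `χ`, placed in
      -- negative indices with the sign `(-1)^n`, bounds the rest. At index `0` its differential is
      -- `-(1 + T) χ_0`, which matches `-ξ`.
      refine Eq.symm ((mk_eq_mk_of_bundle_zero hγ).2 ⟨_, single_mem_symmetricChains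
        (add_mem hχ0 (Tot.T_mem_deg hχ0)), ?_,
        fun s => if s ≤ -1 then sg n • χ (-s - 1).toNat else 0, fun s => ?_, ?_⟩)
      · rw [tateD_single _ _ (by rw [map_add, Tot.T_T, add_comm]), ofQuadratic_φ, zero_φ, sub_zero]
        congr 1
        change ψ 0 + Tot.T C C (ψ 0) = _
        rw [hψ0]
        simp only [map_add, map_sub, map_zsmul, Tot.T_T, Tot.d_T]
        module
      · by_cases hs : s ≤ -1
        · have h := hχ.1 (-s - 1).toNat
          rw [Int.toNat_of_nonneg (by omega), show n + 1 - (-s - 1) = n + 2 + s by ring] at h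
          simpa only [if_pos hs] using zsmul_mem h _
        · simp [hs, zero_mem]
      · funext s
        rw [zero_θ, sub_zero, Pi.sub_apply]
        rcases lt_trichotomy s 0 with hs | rfl | hs
        · obtain ⟨t, rfl⟩ : ∃ t : ℕ, s = -t - 1 := ⟨(-s - 1).toNat, by omega⟩
          have e := quadraticD_tate (n + 1) 1
            (fun s => if s ≤ -1 then sg n • χ (-s - 1).toNat else 0) t
          have e0 : (fun t : ℕ => (1 : ℤ) • (fun s : ℤ => if s ≤ -1 then sg n • χ (-s - 1).toNat
              else 0) (-t - 1)) = sg n • χ := by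
            funext t
            simp only [one_smul]
            rw [if_pos (by omega), show (-(-(t : ℤ) - 1) - 1).toNat = t by omega]
            rfl
          rw [e0, map_zsmul, h, one_smul, add_assoc, show (1 + 1 : ℤ) = 2 by norm_num] at e
          rw [ofQuadratic_θ_of_neg _ _ hs, Pi.single_eq_of_ne hs.ne, sub_zero, ← e,
            show (-(-(t : ℤ) - 1) - 1).toNat = t by omega]
          rfl
        · rw [ofQuadratic_θ_of_nonneg _ _ le_rfl, tateD_apply, Pi.single_eq_same]
          have e : sg (n + 2 + 0 - 1) = -sg n := by
            rw [show n + 2 + 0 - 1 = n + 1 by ring, sg_add, sg_one, mul_neg_one]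
          rw [if_neg (by norm_num), if_pos (by norm_num), e, map_zsmul, map_zero, sg_zero,
            show (-(0 - 1 : ℤ) - 1).toNat = 0 from rfl]
          rcases sg_eq n with h | h <;> rw [h] <;> module
        · rw [ofQuadratic_θ_of_nonneg _ _ hs.le, tateD_apply, Pi.single_eq_of_ne hs.ne',
            if_neg (by omega), if_neg (by omega)]
          simp)

theorem ofQuadraticHom_mk (hγ : γ = 0) (ψ : quadraticCycles C n) :
    ofQuadraticHom hγ (QuadraticQ.mk ψ) = mk (ofQuadratic hγ ψ) := rfl

/-- A null-homotopy gives `η` with `(d η)_s = θ_s` for `s < 0`, so its negative part would bound `ψ`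
if it were finitely supported. Pushing along `p` makes it so, and the homotopy from `p^%` to the
identity corrects the boundary. -/
theorem ofQuadraticHom_injective (hγ : γ = 0) (hC : IsHomotopyBounded C) :
    Function.Injective (ofQuadraticHom (n := n) hγ) := by
  obtain ⟨p, ⟨H⟩, hp⟩ := hC
  rw [injective_iff_map_eq_zero]
  intro q
  obtain ⟨ψ, rfl⟩ := QuotientAddGroup.mk_surjective q
  intro h0
  obtain ⟨ξ, hξ, -, η, hη, h2⟩ := (mk_eq_mk_of_bundle_zero hγ).1
    (show mk 0 = mk (ofQuadratic hγ ψ) from h0.symm)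
  rw [zero_θ, sub_zero] at h2
  set x := ofQuadratic hγ ψ with hx
  obtain ⟨N, hN⟩ : ∃ N : ℤ, ∀ s < N, x.θ s = 0 := by
    obtain ⟨M, hM⟩ := ψ.2.1.2.bddAbove
    refine ⟨-M - 1, fun s hs => ?_⟩
    rw [hx, ofQuadratic_θ_of_neg _ _ (by omega)]
    by_contra h
    have := hM (a := (-s - 1).toNat) (fun h' => h (by rw [h', smul_zero]))
    omega
  have hH := tateHomotopy_mem_tateChains H.hom p x.θ_mem
  rw [show n + 1 + 1 = n + 2 by ring] at hH
  -- The boundary of this chain is `θ - p^% ξ` plus the homotopy applied to `φ`; the last two are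
  -- symmetric chains, so in negative indices only `θ` is left.
  have hη' : tateMap p η - tateHomotopy H.hom p (n + 1) x.θ ∈ tateChains C (n + 1 + 1) := by
    rw [show n + 1 + 1 = n + 2 by ring]
    exact sub_mem (tateMap_mem_tateChains p hη) hH
  have hd := tateD_tateHomotopy H (n + 1) x.θ
  rw [show n + 1 + 1 = n + 2 by ring, add_sub_cancel_right, ← φ_eq_of_bundle_zero x hγ] at hd
  have key : ∀ s < 0, tateD C (n + 2) (tateMap p η - tateHomotopy H.hom p (n + 1) x.θ) s =
      x.θ s := by
    intro s hs
    have h3 := congrFun hd s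
    have h4 := congrArg (Tot.map p p) (congrFun h2 s)
    rw [Pi.add_apply, (tateHomotopy_mem_symmetricChains H.hom p x.φ_mem.1).2 s hs, add_zero,
      Pi.sub_apply, tateMap_apply] at h3
    rw [Pi.sub_apply, hξ.2 s hs, sub_zero] at h4
    rw [map_sub, tateD_tateMap, Pi.sub_apply, tateMap_apply, ← h4, h3, sub_sub_cancel]
  -- Below `-n - 2` the total degree `n + 2 + s` is negative, so `p^% η` vanishes; below `N` the
  -- homotopy term vanishes with `θ`.
  refine (QuotientAddGroup.eq_zero_iff ψ).2 ⟨_, mem_quadraticChains_tate (c := sg n)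
    (N := min N (-n - 2)) hη' fun s hs => ?_, ?_⟩
  · have h5 : s < N := lt_of_lt_of_le hs (min_le_left _ _)
    have h6 : s < -n - 2 := lt_of_lt_of_le hs (min_le_right _ _)
    rw [Pi.sub_apply, tateMap_apply, Tot.map_eq_zero hp (show n + 2 + s < 0 by omega) (hη s)]
    simp [tateHomotopy, hN s h5, hN (s - 1) (by omega)]
  · funext t
    rw [quadraticD_tate, show n + 1 + 1 = n + 2 by ring, key _ (by omega), hx,
      ofQuadratic_θ_of_neg _ _ (by omega), smul_smul, sg_mul_self, one_smul,
      show (-(-(t : ℤ) - 1) - 1).toNat = t by omega]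
    rfl

/-- Every structure is equivalent to its image under `p`, whose `θ` vanishes for very negative `s`.
The negative part of that `θ` is a quadratic structure, because `d θ = φ` is zero in negative
indices. -/
theorem ofQuadraticHom_surjective (hγ : γ = 0) (hC : IsHomotopyBounded C) :
    Function.Surjective (ofQuadraticHom (n := n) hγ) := by
  obtain ⟨p, ⟨H⟩, hp⟩ := hC
  intro q
  obtain ⟨x, rfl⟩ := mk_surjective q
  have hpγ : Bundle.pullback p γ = γ := by rw [hγ, map_zero]
  have hxy : mk x = mk (x.push p hpγ) := by
    refine (mk_eq_mk_of_bundle_zero hγ).2 ⟨tateHomotopy H.hom p n x.φ,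
      tateHomotopy_mem_symmetricChains H.hom p x.φ_mem.1, ?_,
      tateHomotopy H.hom p (n + 1) x.θ, ?_, ?_⟩
    · have h := tateD_tateHomotopy H n x.φ
      rw [show tateD C n x.φ = 0 from x.φ_mem.2] at h
      have h0 : tateHomotopy H.hom p (n - 1) 0 = 0 := by
        funext s
        simp [tateHomotopy]
      rw [h0, add_zero] at h
      exact h.symm
    · have h := tateHomotopy_mem_tateChains H.hom p x.θ_mem
      rwa [show n + 1 + 1 = n + 2 by ring] at h
    · have h := tateD_tateHomotopy H (n + 1) x.θ
      rw [show n + 1 + 1 = n + 2 by ring, add_sub_cancel_right, ← φ_eq_of_bundle_zero x hγ] at h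
      change tateMap p x.θ - x.θ - _ = _
      rw [← h, add_sub_cancel_right]
  rw [hxy]
  set y := x.push p hpγ
  have hy : ∀ s < -n - 1, y.θ s = 0 := fun s hs =>
    Tot.map_eq_zero hp (show n + 1 + s < 0 by omega) (x.θ_mem s)
  let ψ : quadraticCycles C n := ⟨fun t : ℕ => sg n • y.θ (-t - 1),
    mem_quadraticChains_tate y.θ_mem hy, by
      change quadraticD C n _ = 0
      funext t
      rw [quadraticD_tate, ← φ_eq_of_bundle_zero y hγ, y.φ_mem.1.2 _ (by omega), smul_zero]
      rfl⟩
  refine ⟨QuadraticQ.mk ψ, ?_⟩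
  rw [ofQuadraticHom_mk]
  -- The two `θ`-parts agree in negative indices, so their difference is itself a symmetric chain
  -- and serves as the homotopy, with `η = 0`.
  refine (mk_eq_mk_of_bundle_zero hγ).2 ⟨y.θ - (ofQuadratic hγ ψ).θ,
    ⟨sub_mem y.θ_mem (ofQuadratic hγ ψ).θ_mem, fun s hs => ?_⟩, ?_, 0, zero_mem _, ?_⟩
  · rw [Pi.sub_apply, ofQuadratic_θ_of_neg _ _ hs]
    change y.θ s - sg n • sg n • y.θ (-(-s - 1).toNat - 1) = 0
    rw [smul_smul, sg_mul_self, one_smul, show -((-s - 1).toNat : ℤ) - 1 = s by omega, sub_self]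
  · rw [map_sub, ← φ_eq_of_bundle_zero y hγ, ← φ_eq_of_bundle_zero _ hγ]
  · rw [sub_self, map_zero]

variable (n) in
/-- The isomorphism of `Q_n(C)` onto `Q_n(C, 0)`. -/
def quadraticEquiv (hγ : γ = 0) (hC : IsHomotopyBounded C) : QuadraticQ C n ≃+ TwistedQ γ n :=
  AddEquiv.ofBijective (ofQuadraticHom hγ)
    ⟨ofQuadraticHom_injective hγ hC, ofQuadraticHom_surjective hγ hC⟩

end TwistedQ

end

section

variable {A : Type u} [Ring A] [StarRing A]
variable {C C' : ChainComplex (ModuleCat.{u} A) ℤ}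
variable {γ : Bundle C} {γ' : Bundle C'} {n : ℤ}

/-! ### The split short exact sequences for zero bundles. -/

theorem connectingHom_eq_zero (hγ : γ = 0) (hγ' : γ' = 0) : connectingHom γ γ' n = 0 := by
  refine AddMonoidHom.ext fun q => ?_
  obtain ⟨f, rfl⟩ := TensorHomology.mk_surjective q
  subst hγ hγ'
  have h : ∀ {B D : ChainComplex (ModuleCat.{u} A) ℤ} (g : Tot.cycles B D (n + 1)),
      twistCycle (0 : Bundle B) g = 0 := fun g => Subtype.ext (twist_zero_left _ _)
  rw [connectingHom_mk, h, h, neg_zero, ← TwistedQ.ofTateHom_apply, ← TwistedQ.ofTateHom_apply,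
    map_zero, map_zero]
  rfl

theorem SymmetricStructure.push_ofQuadratic {D : ChainComplex (ModuleCat.{u} A) ℤ} {δ : Bundle D}
    (f : C ⟶ D) (hf : Bundle.pullback f δ = γ) (hγ : γ = 0) (hδ : δ = 0)
    (ψ : quadraticCycles C n) :
    (ofQuadratic hγ ψ).push f hf = ofQuadratic hδ (quadraticPush f ψ) := by
  refine SymmetricStructure.ext (funext fun s => ?_) (funext fun s => ?_)
  · change Tot.map f f (if s = 0 then _ else _) =
      if s = 0 then Tot.map f f (ψ.1 0) + Tot.T _ _ (Tot.map f f (ψ.1 0)) else 0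
    rw [apply_ite (Tot.map f f), map_add, map_zero, Tot.T_map]
  · change Tot.map f f (if s ≤ -1 then _ else _) =
      if s ≤ -1 then sg n • Tot.map f f (ψ.1 _) else 0
    rw [apply_ite (Tot.map f f), map_zsmul, map_zero]

/-- The swap terms of the quadratic differential lower the index, so an entry at index `0`
contributes to index `0` only. Every cycle of the tensor product is thereby a quadratic cycle, which
gives the splitting. -/
theorem quadraticD_single (m : ℤ) (w : Tot C C) :
    quadraticD C m (Pi.single 0 w) = Pi.single 0 (Tot.d C C w) := by
  let v : ℕ → Tot C C := Pi.single 0 w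
  funext s
  change Tot.d C C (v s) + sg (m - s - 1) • (v (s + 1) + sg (s + 1) • Tot.T C C (v (s + 1))) = _
  rw [show v (s + 1) = 0 from Pi.single_eq_of_ne (Nat.succ_ne_zero s) w, map_zero, smul_zero,
    add_zero, smul_zero, add_zero]
  exact Pi.apply_single (fun _ => Tot.d C C) (fun _ => map_zero _) 0 w s

theorem single_mem_quadraticChains {m : ℤ} {w : Tot C C} (hw : w ∈ Tot.deg C C m) :
    (Pi.single 0 w : ℕ → Tot C C) ∈ quadraticChains C m := by
  refine ⟨fun s => ?_, (Set.finite_singleton 0).subset Pi.support_single_subset⟩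
  rcases eq_or_ne s 0 with rfl | hs
  · simpa using hw
  · simp [hs, zero_mem]

variable (C C' n) in
/-- The splitting `f ↦ (i ⊗ i') f` of the projection of `Q_n(C ⊕ C')` onto `H_n(C^t ⊗_A C')`. -/
def quadraticSection : TensorHomology C C' n →+ QuadraticQ (C ⊞ C') n :=
  QuotientAddGroup.map _ _
    (((AddMonoidHom.single (fun _ : ℕ => Tot (C ⊞ C') (C ⊞ C')) 0).comp
      ((Tot.map biprod.inl biprod.inr).comp (Tot.cycles C C' n).subtype)).codRestrict
        (quadraticCycles (C ⊞ C') n) fun f =>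
      ⟨single_mem_quadraticChains (Tot.map_mem _ _ f.2.1), by
        refine (quadraticD_single n _).trans ?_
        rw [AddMonoidHom.comp_apply, Tot.d_map, AddSubgroup.subtype_apply,
          show Tot.d _ _ f.1 = 0 from f.2.2, map_zero, Pi.single_zero]⟩)
    (by
      rintro f ⟨g, hg, h⟩
      refine ⟨Pi.single 0 (Tot.map biprod.inl biprod.inr g),
        single_mem_quadraticChains (Tot.map_mem _ _ hg), (quadraticD_single _ _).trans ?_⟩
      rw [Tot.d_map, show Tot.d _ _ g = f.1 from h]
      rfl)

end

end

end ChainBundle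

theorem mainTheorem5 {A : Type u} [Ring A] [StarRing A]
    (C C' : ChainComplex (ModuleCat.{u} A) ℤ)
    (hC : IsFiniteDimensional C) (hC' : IsFiniteDimensional C')
    (γ : Bundle C) (γ' : Bundle C') :
    ∃ (i : ∀ n : ℤ, TwistedQ γ n × TwistedQ γ' n →+ TwistedQ (γ.directSum γ') n)
      (j : ∀ n : ℤ, TwistedQ (γ.directSum γ') n →+ TensorHomology C C' n)
      (k : ∀ n : ℤ, TensorHomology C C' (n + 1) →+ TwistedQ γ n × TwistedQ γ' n),
      -- the maps
      (∀ (n : ℤ) (x : SymmetricStructure γ n) (x' : SymmetricStructure γ' n),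
        i n (TwistedQ.mk x, TwistedQ.mk x') =
          TwistedQ.mk (x.push biprod.inl (Bundle.pullback_inl γ γ')) +
            TwistedQ.mk (x'.push biprod.inr (Bundle.pullback_inr γ γ'))) ∧
      (∀ (n : ℤ) (y : SymmetricStructure (γ.directSum γ') n),
        j n (TwistedQ.mk y) = TensorHomology.mk (y.zeroCycle biprod.fst biprod.snd)) ∧
      (∀ (n : ℤ) (f : Tot.cycles C C' (n + 1)),
        k n (TensorHomology.mk f) =
          (TwistedQ.mk (SymmetricStructure.ofTate γ (twistCycle γ' (transposeCycle f))),
            TwistedQ.mk (SymmetricStructure.ofTate γ' (-twistCycle γ f)))) ∧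
      -- the long exact sequence
      (∀ n : ℤ, Function.Exact (i n) (j n)) ∧
      (∀ n : ℤ, Function.Exact (j (n + 1)) (k n)) ∧
      (∀ n : ℤ, Function.Exact (k n) (i n)) ∧
      -- the untwisted case
      (∀ (hγ : γ = 0) (hγ' : γ' = 0) (n : ℤ),
        k n = 0 ∧
        ∃ (e : QuadraticQ C n ≃+ TwistedQ γ n) (e' : QuadraticQ C' n ≃+ TwistedQ γ' n)
          (e'' : QuadraticQ (C ⊞ C') n ≃+ TwistedQ (γ.directSum γ') n)
          (a : QuadraticQ C n × QuadraticQ C' n →+ QuadraticQ (C ⊞ C') n)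
          (b : QuadraticQ (C ⊞ C') n →+ TensorHomology C C' n)
          (r : TensorHomology C C' n →+ QuadraticQ (C ⊞ C') n),
          (∀ ψ, e (QuadraticQ.mk ψ) = TwistedQ.mk (SymmetricStructure.ofQuadratic hγ ψ)) ∧
          (∀ ψ, e' (QuadraticQ.mk ψ) = TwistedQ.mk (SymmetricStructure.ofQuadratic hγ' ψ)) ∧
          (∀ ψ, e'' (QuadraticQ.mk ψ) = TwistedQ.mk
            (SymmetricStructure.ofQuadratic (Bundle.directSum_eq_zero hγ hγ') ψ)) ∧
          (∀ ψ ψ', a (QuadraticQ.mk ψ, QuadraticQ.mk ψ') =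
            QuadraticQ.mk (quadraticPush biprod.inl ψ) +
              QuadraticQ.mk (quadraticPush biprod.inr ψ')) ∧
          (∀ ψ, b (QuadraticQ.mk ψ) =
            TensorHomology.mk (quadraticZeroCycle biprod.fst biprod.snd ψ)) ∧
          (∀ z z', i n (e z, e' z') = e'' (a (z, z'))) ∧
          (∀ z, j n (e'' z) = b z) ∧
          Function.Injective a ∧ Function.Exact a b ∧ Function.Surjective b ∧
          b.comp r = AddMonoidHom.id _) := by
  refine ⟨inclHom γ γ', crossHom γ γ', connectingHom γ γ', fun n => inclHom_mk,
    fun n => crossHom_mk, fun n => connectingHom_mk, exact_inclHom_crossHom γ γ',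
    exact_crossHom_connectingHom γ γ', exact_connectingHom_inclHom γ γ', fun hγ hγ' n => ?_⟩
  have bC := hC.isHomotopyBounded
  have bC' := hC'.isHomotopyBounded
  have hδ := Bundle.directSum_eq_zero hγ hγ'
  have hk := connectingHom_eq_zero (n := n) hγ hγ'
  let e := TwistedQ.quadraticEquiv n hγ bC
  let e' := TwistedQ.quadraticEquiv n hγ' bC'
  let e'' := TwistedQ.quadraticEquiv n hδ (bC.biprod bC')
  -- The kernel of `i_*` is the image of `k_* = 0`.
  have hi : Function.Injective (inclHom γ γ' n) := by
    rw [injective_iff_map_eq_zero]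
    intro q hq
    obtain ⟨f, rfl⟩ := (exact_connectingHom_inclHom γ γ' n q).1 hq
    rw [hk, AddMonoidHom.zero_apply]
  -- Symmetrizing `(i ⊗ i') f` adds its transpose, which lies in the other off-diagonal block and is
  -- killed by `j ⊗ j'`.
  have hr : ((crossHom γ γ' n).comp e''.toAddMonoidHom).comp (quadraticSection C C' n) =
      AddMonoidHom.id _ := by
    refine AddMonoidHom.ext fun q => ?_
    obtain ⟨f, rfl⟩ := TensorHomology.mk_surjective q
    refine congrArg TensorHomology.mk (Subtype.ext ?_)
    change Tot.map biprod.fst biprod.snd (Tot.map biprod.inl biprod.inr f.1 +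
      Tot.T _ _ (Tot.map biprod.inl biprod.inr f.1)) = f.1
    rw [Tot.T_map]
    simp [Tot.map_map, Tot.map_id, Tot.map_zero_left]
  -- The quadratic maps are defined by transporting `i_*` and `j_*` through the isomorphisms. The
  -- compatibilities and exactness are then inherited, and the formula for the first map follows
  -- from `push_ofQuadratic`.
  refine ⟨hk, e, e', e'', e''.symm.toAddMonoidHom.comp ((inclHom γ γ' n).comp
    (e.toAddMonoidHom.prodMap e'.toAddMonoidHom)), (crossHom γ γ' n).comp e''.toAddMonoidHom,
    quadraticSection C C' n, fun ψ => rfl, fun ψ => rfl, fun ψ => rfl, fun ψ ψ' => ?_,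
    fun ψ => rfl, fun z z' => (e''.apply_symm_apply _).symm, fun z => rfl, ?_, ?_, ?_, hr⟩
  · refine (AddEquiv.symm_apply_eq e'').2 ?_
    rw [map_add]
    change TwistedQ.mk _ + TwistedQ.mk _ = TwistedQ.mk _ + TwistedQ.mk _
    rw [SymmetricStructure.push_ofQuadratic _ _ _ hδ, SymmetricStructure.push_ofQuadratic _ _ _ hδ]
  · exact e''.symm.injective.comp (hi.comp (e.injective.prodMap e'.injective))
  · intro z
    refine (exact_inclHom_crossHom γ γ' n (e'' z)).trans ⟨?_, ?_⟩
    · rintro ⟨⟨q, q'⟩, h⟩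
      refine ⟨(e.symm q, e'.symm q'), (AddEquiv.symm_apply_eq e'').2 ?_⟩
      change inclHom γ γ' n (e (e.symm q), e' (e'.symm q')) = _
      rw [e.apply_symm_apply, e'.apply_symm_apply, h]
    · rintro ⟨⟨q, q'⟩, h⟩
      exact ⟨(e q, e' q'), (AddEquiv.symm_apply_eq e'').1 h⟩
  · exact fun q => ⟨_, DFunLike.congr_fun hr q⟩
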